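/- Let $d \ge 1$, let $\mathcal I$ be a nonempty set which is finite or countably infinite, and let $\mathsf A=(A_i)_{i\in\mathcal I}$ be a tuple of invertible real $d\times d$ matrices with $\sup_{i\in\mathcal I}\|A_i\|<\tfrac12$, where $\|\cdot\|$ is the operator norm induced by the Euclidean norm. For a real $d \times d$ matrix $A$ with singular values $\sigma_1(A)\ge\dots\ge\sigma_d(A)$ and $s\ge0$ put $\varphi^s(A)=\sigma_1(A)\cdots\sigma_{\lfloor s\rfloor}(A)\,\sigma_{\lceil s\rceil}(A)^{s-\lfloor s\rfloor}$ if $s\le d$ and $\varphi^s(A)=|\det A|^{s/d}$ if $s>d$. For a nonempty finite set $\mathcal J\subseteq\mathcal I$ let $$P_{\mathcal J}(s)=\lim_{n\to\infty}\frac1n\log\sum_{(i_1,\dots,i_n)\in\mathcal J^n}\varphi^s(A_{i_1}\cdots A_{i_n}),$$ and define the lower affinity dimension of $\mathsf A$ by $$\underline{\dim}_{\mathrm{aff}}\,\mathsf A=\sup\bigl\{\inf\{s\ge0: P_{\mathcal J}(s)<0\} : \mathcal J\subseteq\mathcal I \text{ nonempty and finite}\bigr\}\in[0,\infty].$$ For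 $\mathsf v=(v_i)_{i\in\mathcal I}\in\mathbf Q=([0,1]^d)^{\mathcal I}$ let $T_i(x)=A_ix+v_i$, and let $X_{\mathsf v}\subset\mathbb R^d$ be the self-affine set (limit set) of $(T_i)_{i\in\mathcal I}$, that is, the set of all $x\in\mathbb R^d$ for which there is a sequence $(i_n)_{n\ge1}$ in $\mathcal I$ such that $\lim_{n\to\infty}T_{i_1}\circ\cdots\circ T_{i_n}(y)=x$ for every $y\in\mathbb R^d$. Let $\mathcal L_{\mathbf Q}$ be the product probability measure on $\mathbf Q$ each of whose factors is Lebesgue measure on $[0,1]^d$. Then $$\dim_{\mathrm H}X_{\mathsf v}\ \ge\ \min\{d,\ \underline{\dim}_{\mathrm{aff}}\,\mathsf A\}\qquad\text{for }\mathcal L_{\mathbf Q}\text{-almost every }\mathsf v\in\mathbf Q.$$ -/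

import Mathlib

open MeasureTheory Filter Topology
open scoped ENNReal NNReal

noncomputable section

namespace SelfAffine

/-- `σ_{k+1}(M)`: the singular values of `M` in non-increasing order, indexed from `0`. -/
def singularValue {d : ℕ} (M : Matrix (Fin d) (Fin d) ℝ) (k : ℕ) : ℝ :=
  (Matrix.toEuclideanLin M).singularValues k

/-- The singular value function `φ^s(M)`. The singular values are indexed from `0`, so for
non-integer `s` the factor `σ_{⌈s⌉}` is the one of index `⌊s⌋`; for integer `s` its exponent
is `0`. -/
def svf {d : ℕ} (s : ℝ≥0) (M : Matrix (Fin d) (Fin d) ℝ) : ℝ :=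
  if s ≤ d then
    (∏ k ∈ Finset.range ⌊s⌋₊, singularValue M k) *
      singularValue M ⌊s⌋₊ ^ ((s : ℝ) - (⌊s⌋₊ : ℝ))
  else |M.det| ^ ((s : ℝ) / (d : ℝ))

/-- `A_{i_1} ⋯ A_{i_n}` for the word `w = (i_1, …, i_n)`. -/
def wordProd {d : ℕ} {ι : Type*} (A : ι → GL (Fin d) ℝ) {n : ℕ} (w : Fin n → ι) :
    GL (Fin d) ℝ :=
  (List.ofFn fun k => A (w k)).prod

/-- `∑_{(i_1, …, i_n)} φ^s(A_{i_1} ⋯ A_{i_n})`, with values in `[0, ∞]`. -/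
def svfSum {d : ℕ} {ι : Type*} (A : ι → GL (Fin d) ℝ) (s : ℝ≥0) (n : ℕ) : ℝ≥0∞ :=
  ∑' w : Fin n → ι, ENNReal.ofReal (svf s (wordProd A w : Matrix (Fin d) (Fin d) ℝ))

/-- The pressure `P(A, s)`, with values in the extended reals. The limit of
`(1 / n) log ∑ φ^s` always exists, so it is the upper limit. -/
def pressure {d : ℕ} {ι : Type*} (A : ι → GL (Fin d) ℝ) (s : ℝ≥0) : EReal :=
  limsup (fun n : ℕ => ENNReal.log (svfSum A s n) / (n : EReal)) atTop

/-- The upper affinity dimension `inf {s ≥ 0 : P(A, s) < 0}`, where `inf ∅ = ∞`. -/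
def upperAffinityDim {d : ℕ} {ι : Type*} (A : ι → GL (Fin d) ℝ) : ℝ≥0∞ :=
  ⨅ (s : ℝ≥0) (_ : pressure A s < 0), (s : ℝ≥0∞)

/-- The lower affinity dimension: the supremum of the upper affinity dimensions of the
nonempty finite subtuples. -/
def lowerAffinityDim {d : ℕ} {ι : Type*} (A : ι → GL (Fin d) ℝ) : ℝ≥0∞ :=
  ⨆ (J : Finset ι) (_ : J.Nonempty), upperAffinityDim (fun i : J => A i)

/-- The affine map `T_i(x) = A_i x + v_i`. -/
def affineMap {d : ℕ} {ι : Type*} (A : ι → GL (Fin d) ℝ)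
    (v : ι → EuclideanSpace ℝ (Fin d)) (i : ι) (x : EuclideanSpace ℝ (Fin d)) :
    EuclideanSpace ℝ (Fin d) :=
  Matrix.toEuclideanLin (A i : Matrix (Fin d) (Fin d) ℝ) x + v i

/-- `S 0 ∘ S 1 ∘ ⋯ ∘ S (n - 1)`. -/
def iterComp {X : Type*} (S : ℕ → X → X) : ℕ → X → X
  | 0 => id
  | n + 1 => iterComp S n ∘ S n

/-- The self-affine set `X_v`, that is, the set of all limit points of the system `(T_i)`:
the points `x` for which there is a sequence `(i_n)` such that
`T_{i_1} ∘ ⋯ ∘ T_{i_n} (y) → x` for every `y`. -/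
def selfAffineSet {d : ℕ} {ι : Type*} (A : ι → GL (Fin d) ℝ)
    (v : ι → EuclideanSpace ℝ (Fin d)) : Set (EuclideanSpace ℝ (Fin d)) :=
  {x | ∃ w : ℕ → ι, ∀ y : EuclideanSpace ℝ (Fin d),
    Tendsto (fun n => iterComp (fun k => affineMap A v (w k)) n y) atTop (𝓝 x)}

/-- The unit cube `[0,1]^d`. -/
def unitCube (d : ℕ) : Set (EuclideanSpace ℝ (Fin d)) :=
  {x | ∀ k, x k ∈ Set.Icc (0 : ℝ) 1}

/-- Lebesgue measure restricted to the unit cube. -/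
def cubeMeasure (d : ℕ) : Measure (EuclideanSpace ℝ (Fin d)) :=
  volume.restrict (unitCube d)

theorem volume_unitCube (d : ℕ) : volume (unitCube d) = 1 := by
  have h : unitCube d = (WithLp.ofLp : EuclideanSpace ℝ (Fin d) → (Fin d → ℝ)) ⁻¹'
      (Set.univ.pi fun _ => Set.Icc (0 : ℝ) 1) := by
    ext x
    simp only [unitCube, Set.mem_ofPred_eq, Set.mem_preimage, Set.mem_univ_pi]
  rw [h, (PiLp.volume_preserving_ofLp (Fin d)).measure_preimage
    (MeasurableSet.univ_pi fun _ => measurableSet_Icc).nullMeasurableSet, volume_pi_pi]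
  simp

instance isProbabilityMeasure_cubeMeasure (d : ℕ) : IsProbabilityMeasure (cubeMeasure d) :=
  ⟨by rw [cubeMeasure, Measure.restrict_apply_univ, volume_unitCube]⟩

/-- The product probability measure on `([0,1]^d)^ι`, as a measure on `(ℝ^d)^ι`. -/
def translationMeasure (d : ℕ) (ι : Type*) : Measure (ι → EuclideanSpace ℝ (Fin d)) :=
  Measure.infinitePi fun _ : ι => cubeMeasure d

end SelfAffine

end

/-!
Let `τ < t < s` be smaller than `d` and the affinity dimension of a finite subsystem. The pressure
of the subsystem at `s` is nonnegative, so the sum of `φ^s(A_w)` over all words `w` diverges.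
Since `φ^s` is submultiplicative up to a constant, limits of the normalized weights of the
extensions of `w` define a probability measure `μ` on sequences with `μ [w] ≤ K φ^s(A_w)`.
As the norms are below `1/2`, for two sequences with different first letters the difference of the
two coded points, as a function of one suitable translation, is affine with a bounded inverse.
So the points with addresses `x` and `y` are at distance at most `r` with probability at most a
constant times `r ^ t / φ^t(A_w)`, where `w` is the longest common prefix of `x` and `y`. Hence
the expected `τ`-energy of the image of `μ` is finite, and the dimension is almost surely at
least `τ`.
-/

noncomputable section

namespace SelfAffine

section SingularValues

open Module

variable {E F : Type*} [NormedAddCommGroup E] [InnerProductSpace ℝ E] [NormedAddCommGroup F]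
  [InnerProductSpace ℝ F]

theorem norm_map_le_of_forall_abs_repr_mul_le {ι : Type*} [Fintype ι] (e : OrthonormalBasis ι ℝ E)
    (T : E →ₗ[ℝ] F) {u : E} {r : ℝ} (hr : 0 ≤ r)
    (h : ∀ i, |e.repr u i| * ‖T (e i)‖ ≤ (Fintype.card ι : ℝ)⁻¹ * r) : ‖T u‖ ≤ r := by
  rw [← e.sum_repr u, map_sum]
  calc ‖∑ i, T (e.repr u i • e i)‖
      ≤ ∑ i, |e.repr u i| * ‖T (e i)‖ := norm_sum_le_of_le _ fun i _ => by
        rw [map_smul, norm_smul, Real.norm_eq_abs]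
    _ ≤ Fintype.card ι * ((Fintype.card ι : ℝ)⁻¹ * r) := by
        simpa using Finset.sum_le_sum fun i (_ : i ∈ Finset.univ) => h i
    _ ≤ r := by
        rw [← mul_assoc]
        exact mul_le_of_le_one_left hr mul_inv_le_one

variable [FiniteDimensional ℝ E] [FiniteDimensional ℝ F]

theorem exists_orthonormalBasis_singularValues (T : E →ₗ[ℝ] F) :
    ∃ e : OrthonormalBasis (Fin (finrank ℝ E)) ℝ E,
      (∀ i, ‖T (e i)‖ = T.singularValues i) ∧
        ∀ u (i : Fin (finrank ℝ E)), T.singularValues i * |e.repr u i| ≤ ‖T u‖ := by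
  have hS := T.isSymmetric_adjoint_comp_self
  set e := hS.eigenvectorBasis rfl
  have norm_sq_eq (u : E) : ‖T u‖ ^ 2 =
      ∑ i : Fin (finrank ℝ E), (T.singularValues i * e.repr u i) ^ 2 := by
    have h_adjoint : ‖T u‖ ^ 2 = inner ℝ u ((T.adjoint ∘ₗ T) u) := by
      rw [LinearMap.comp_apply, LinearMap.adjoint_inner_right, real_inner_self_eq_norm_sq]
    rw [h_adjoint, ← e.sum_inner_mul_inner]
    refine Finset.sum_congr rfl fun i _ => ?_
    rw [mul_pow, T.sq_singularValues_fin rfl i, ← hS _ u, hS.apply_eigenvectorBasis,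
      OrthonormalBasis.repr_apply_apply, inner_smul_left, real_inner_comm]
    simp only [RCLike.conj_to_real, RCLike.ofReal_real_eq_id, id_eq]
    ring
  refine ⟨e, fun i => ?_, fun u i => ?_⟩
  · rw [← pow_left_inj₀ (norm_nonneg _) (T.singularValues_nonneg i) two_ne_zero, norm_sq_eq,
      Finset.sum_eq_single i (fun j _ hj => by simp [hj]) (by simp)]
    simp
  · refine le_of_sq_le_sq ?_ (norm_nonneg _)
    rw [mul_pow, sq_abs, ← mul_pow, norm_sq_eq]
    exact Finset.single_le_sum
      (f := fun i : Fin (finrank ℝ E) => (T.singularValues i * e.repr u i) ^ 2)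
      (fun _ _ => sq_nonneg _) (Finset.mem_univ i)

theorem singularValues_le_of_forall_norm_le {T : E →ₗ[ℝ] F} {a : ℝ} (hT : ∀ u, ‖T u‖ ≤ a * ‖u‖)
    {i : ℕ} (hi : i < finrank ℝ E) : T.singularValues i ≤ a := by
  obtain ⟨e, norm_map_e, -⟩ := exists_orthonormalBasis_singularValues T
  simpa [norm_map_e] using hT (e ⟨i, hi⟩)

theorem singularValues_pos {T : E →ₗ[ℝ] F} (hT : Function.Injective T) {i : ℕ}
    (hi : i < finrank ℝ E) : 0 < T.singularValues i :=
  T.injective_iff_forall_lt_finrank_singularValues_pos.1 hT i hi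

/-- The exponent of the singular value of index `i` (counted from `0`) in the singular value
function `φ^s`: it is `1` for `i < ⌊s⌋`, the fractional part of `s` for `i = ⌊s⌋`, and `0` for
`i > ⌊s⌋`. -/
def singularExponent (s : ℝ) (i : ℕ) : ℝ :=
  max 0 (min 1 (s - i))

theorem singularExponent_nonneg (s : ℝ) (i : ℕ) : 0 ≤ singularExponent s i :=
  le_max_left _ _

theorem singularExponent_le_one (s : ℝ) (i : ℕ) : singularExponent s i ≤ 1 :=
  max_le zero_le_one (min_le_left _ _)

theorem singularExponent_mono {s t : ℝ} (hst : s ≤ t) (i : ℕ) :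
    singularExponent s i ≤ singularExponent t i :=
  max_le_max_left _ (min_le_min_left _ (sub_le_sub_right hst _))

theorem singularExponent_eq_one {s : ℝ} {i : ℕ} (h : i + 1 ≤ s) : singularExponent s i = 1 := by
  rw [singularExponent, min_eq_left (by linarith), max_eq_right zero_le_one]

theorem singularExponent_eq_sub {s : ℝ} {i : ℕ} (h : i ≤ s) (h' : s ≤ i + 1) :
    singularExponent s i = s - i := by
  rw [singularExponent, min_eq_right (by linarith), max_eq_right (by linarith)]

theorem singularExponent_eq_zero {s : ℝ} {i : ℕ} (h : s ≤ i) : singularExponent s i = 0 :=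
  max_eq_left ((min_le_right _ _).trans (by linarith))

theorem sum_range_singularExponent {s : ℝ} (hs : 0 ≤ s) (n : ℕ) :
    ∑ i ∈ Finset.range n, singularExponent s i = min s n := by
  induction n with
  | zero => simp [hs]
  | succ n ih =>
    rw [Finset.sum_range_succ, ih, Nat.cast_succ]
    rcases le_total s n with h | h
    · rw [singularExponent_eq_zero h, min_eq_left h, min_eq_left (by linarith), add_zero]
    rcases le_total s (n + 1) with h' | h'
    · rw [singularExponent_eq_sub h h', min_eq_right h, min_eq_left h']
      ring
    · rw [singularExponent_eq_one h', min_eq_right h, min_eq_right h']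

/-- The singular value function `φ^s(T)` of a linear map, for `0 ≤ s ≤ finrank ℝ E`, written as a
product over all singular values in order to treat integer and non-integer `s` alike. -/
def singularValueFunction (s : ℝ) (T : E →ₗ[ℝ] F) : ℝ :=
  ∏ i ∈ Finset.range (finrank ℝ E), T.singularValues i ^ singularExponent s i

theorem singularValueFunction_pos {T : E →ₗ[ℝ] F} (hT : Function.Injective T) (s : ℝ) :
    0 < singularValueFunction s T :=
  Finset.prod_pos fun _ hi => Real.rpow_pos_of_pos (singularValues_pos hT (Finset.mem_range.1 hi)) _

theorem singularValueFunction_eq_prod_range_floor (T : E →ₗ[ℝ] F) {s : ℝ} (hs : 0 ≤ s)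
    (hsn : s < finrank ℝ E) :
    singularValueFunction s T =
      (∏ i ∈ Finset.range ⌊s⌋₊, T.singularValues i) *
        T.singularValues ⌊s⌋₊ ^ (s - (⌊s⌋₊ : ℝ)) := by
  have floor_lt : ⌊s⌋₊ < finrank ℝ E := (Nat.floor_lt hs).2 hsn
  rw [singularValueFunction, ← Finset.prod_range_mul_prod_Ico _ (Nat.succ_le_of_lt floor_lt),
    Finset.prod_range_succ, Finset.prod_eq_one (s := Finset.Ico _ _), mul_one]
  · congr 1
    · refine Finset.prod_congr rfl fun i hi => ?_
      have : ((i + 1 : ℕ) : ℝ) ≤ s := (Nat.le_floor_iff hs).1 (Finset.mem_range.1 hi)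
      rw [singularExponent_eq_one (by simpa using this), Real.rpow_one]
    · rw [singularExponent_eq_sub (Nat.floor_le hs) (Nat.lt_floor_add_one s).le]
  · intro i hi
    rw [singularExponent_eq_zero ((Nat.floor_lt hs).1 (Finset.mem_Ico.1 hi).1).le, Real.rpow_zero]

theorem singularValueFunction_le_rpow_mul {T : E →ₗ[ℝ] F} (hT : Function.Injective T) {a : ℝ}
    (ha : 0 < a) (hTa : ∀ u, ‖T u‖ ≤ a * ‖u‖) {s t : ℝ} (ht : 0 ≤ t) (hts : t ≤ s)
    (hs : s ≤ finrank ℝ E) :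
    singularValueFunction s T ≤ a ^ (s - t) * singularValueFunction t T := by
  have sum_sub : ∑ i ∈ Finset.range (finrank ℝ E), (singularExponent s i - singularExponent t i) =
      s - t := by
    rw [Finset.sum_sub_distrib, sum_range_singularExponent ht,
      sum_range_singularExponent (ht.trans hts), min_eq_left hs, min_eq_left (hts.trans hs)]
  rw [← sum_sub, Real.rpow_sum_of_pos ha, singularValueFunction, singularValueFunction,
    ← Finset.prod_mul_distrib]
  refine Finset.prod_le_prod (fun i _ => Real.rpow_nonneg (T.singularValues_nonneg i) _)
    fun i hi => ?_
  have hi := Finset.mem_range.1 hi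
  calc T.singularValues i ^ singularExponent s i
      = T.singularValues i ^ (singularExponent s i - singularExponent t i) *
          T.singularValues i ^ singularExponent t i := by
        rw [← Real.rpow_add (singularValues_pos hT hi), sub_add_cancel]
    _ ≤ a ^ (singularExponent s i - singularExponent t i) *
          T.singularValues i ^ singularExponent t i := by
        refine mul_le_mul_of_nonneg_right ?_ (Real.rpow_nonneg (T.singularValues_nonneg i) _)
        exact Real.rpow_le_rpow (T.singularValues_nonneg i)
          (singularValues_le_of_forall_norm_le hTa hi) (sub_nonneg.2 (singularExponent_mono hts i))

theorem singularValueFunction_zero (T : E →ₗ[ℝ] F) : singularValueFunction 0 T = 1 :=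
  Finset.prod_eq_one fun i _ => by
    rw [singularExponent_eq_zero i.cast_nonneg, Real.rpow_zero]

/-- The volume of `{u | ‖u‖ ≤ 1 ∧ ‖T u‖ ≤ r}` up to a constant depending on the dimension only:
this set is comparable to a box with sides `min 1 (r / σᵢ)`. -/
def singularBoxVolume (T : E →ₗ[ℝ] F) (r : ℝ) : ℝ :=
  ∏ i ∈ Finset.range (finrank ℝ E), min 1 (r / T.singularValues i)

theorem prod_div_singularValues_rpow {T : E →ₗ[ℝ] F} {s r : ℝ} (hs : 0 ≤ s)
    (hsn : s ≤ finrank ℝ E) (hr : 0 < r) :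
    ∏ i ∈ Finset.range (finrank ℝ E), (r / T.singularValues i) ^ singularExponent s i =
      r ^ s / singularValueFunction s T := by
  have sum_eq : s = ∑ i ∈ Finset.range (finrank ℝ E), singularExponent s i := by
    rw [sum_range_singularExponent hs, min_eq_left hsn]
  conv_rhs => rw [sum_eq, Real.rpow_sum_of_pos hr, ← sum_eq]
  rw [singularValueFunction, ← Finset.prod_div_distrib]
  exact Finset.prod_congr rfl fun i _ => Real.div_rpow hr.le (T.singularValues_nonneg i) _

theorem singularBoxVolume_le {T : E →ₗ[ℝ] F} {s r : ℝ} (hs : 0 ≤ s) (hsn : s ≤ finrank ℝ E)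
    (hr : 0 < r) : singularBoxVolume T r ≤ r ^ s / singularValueFunction s T := by
  rw [← prod_div_singularValues_rpow hs hsn hr]
  have ratio_nonneg (i : ℕ) : 0 ≤ r / T.singularValues i :=
    div_nonneg hr.le (T.singularValues_nonneg i)
  refine Finset.prod_le_prod (fun i _ => le_min zero_le_one (ratio_nonneg i)) fun i _ => ?_
  rcases le_total 1 (r / T.singularValues i) with h | h
  · exact (min_le_left _ _).trans (Real.one_le_rpow h (singularExponent_nonneg s i))
  · exact (min_le_right _ _).trans
      (Real.self_le_rpow_of_le_one (ratio_nonneg i) h (singularExponent_le_one s i))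

theorem singularBoxVolume_singularValues_floor {T : E →ₗ[ℝ] F} (hT : Function.Injective T) {s : ℝ}
    (hs : 0 ≤ s) (hsn : s < finrank ℝ E) :
    singularBoxVolume T (T.singularValues ⌊s⌋₊) =
      T.singularValues ⌊s⌋₊ ^ s / singularValueFunction s T := by
  have r_pos : 0 < T.singularValues ⌊s⌋₊ := singularValues_pos hT ((Nat.floor_lt hs).2 hsn)
  rw [← prod_div_singularValues_rpow hs hsn.le r_pos]
  refine Finset.prod_congr rfl fun i hi => ?_
  have σ_pos : 0 < T.singularValues i := singularValues_pos hT (Finset.mem_range.1 hi)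
  rcases lt_trichotomy i ⌊s⌋₊ with h | rfl | h
  · have : ((i + 1 : ℕ) : ℝ) ≤ s := (Nat.le_floor_iff hs).1 h
    rw [singularExponent_eq_one (by simpa using this), Real.rpow_one,
      min_eq_right ((div_le_one σ_pos).2 (T.singularValues_antitone h.le))]
  · rw [div_self r_pos.ne', min_self, Real.one_rpow]
  · rw [singularExponent_eq_zero ((Nat.floor_lt hs).1 h).le, Real.rpow_zero,
      min_eq_left ((one_le_div σ_pos).2 (T.singularValues_antitone h.le))]


theorem prod_fin_singularBox (T : E →ₗ[ℝ] F) (c r : ℝ) :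
    ∏ i : Fin (finrank ℝ E), c * min 1 (r / T.singularValues i) =
      c ^ finrank ℝ E * singularBoxVolume T r := by
  rw [Finset.prod_mul_distrib, Finset.prod_const, Finset.card_univ, Fintype.card_fin,
    singularBoxVolume, Fin.prod_univ_eq_prod_range (fun i => min 1 (r / T.singularValues i))]

section Volume

variable [MeasurableSpace E] [BorelSpace E]

theorem volume_setOf_abs_repr_le {ι : Type*} [Fintype ι] (e : OrthonormalBasis ι ℝ E)
    {b : ι → ℝ} (hb : ∀ i, 0 ≤ b i) :
    volume {u : E | ∀ i, |e.repr u i| ≤ b i} = ENNReal.ofReal (∏ i, 2 * b i) := by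
  have eq_preimage : {u : E | ∀ i, |e.repr u i| ≤ b i} =
      e.repr ⁻¹' (WithLp.ofLp ⁻¹' Set.univ.pi fun i => Set.Icc (-b i) (b i)) := by
    ext u
    simp only [abs_le, Set.mem_ofPred_eq, Set.mem_preimage, Set.mem_univ_pi, Set.mem_Icc]
  have hm : MeasurableSet (Set.univ.pi fun i => Set.Icc (-b i) (b i)) :=
    MeasurableSet.univ_pi fun _ => measurableSet_Icc
  have h_ofLp := PiLp.volume_preserving_ofLp ι
  rw [eq_preimage,
    e.measurePreserving_repr.measure_preimage (h_ofLp.measurable hm).nullMeasurableSet,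
    h_ofLp.measure_preimage hm.nullMeasurableSet, volume_pi_pi,
    ENNReal.ofReal_prod_of_nonneg fun i _ => mul_nonneg zero_le_two (hb i)]
  exact Finset.prod_congr rfl fun i _ => by rw [Real.volume_Icc, sub_neg_eq_add, two_mul]

theorem volume_closedBall_inter_preimage_le {T : E →ₗ[ℝ] F} (hT : Function.Injective T)
    {R r : ℝ} (hR : 1 ≤ R) (hr : 0 ≤ r) :
    volume (Metric.closedBall 0 R ∩ T ⁻¹' Metric.closedBall 0 r) ≤
      ENNReal.ofReal ((2 * R) ^ finrank ℝ E * singularBoxVolume T r) := by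
  obtain ⟨e, -, σ_mul_repr_le⟩ := exists_orthonormalBasis_singularValues T
  have subset_box : Metric.closedBall 0 R ∩ T ⁻¹' Metric.closedBall 0 r ⊆
      {u | ∀ i : Fin (finrank ℝ E), |e.repr u i| ≤ R * min 1 (r / T.singularValues i)} := by
    rintro u ⟨hu, hTu⟩ i
    rw [mem_closedBall_zero_iff] at hu
    rw [Set.mem_preimage, mem_closedBall_zero_iff] at hTu
    rw [mul_min_of_nonneg _ _ (zero_le_one.trans hR), mul_one, le_min_iff]
    have repr_le : |e.repr u i| ≤ ‖u‖ := by
      simpa using PiLp.norm_apply_le (e.repr u) i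
    have repr_le_div : |e.repr u i| ≤ r / T.singularValues i :=
      (le_div_iff₀' (singularValues_pos hT i.2)).2 ((σ_mul_repr_le u i).trans hTu)
    exact ⟨repr_le.trans hu, repr_le_div.trans <| le_mul_of_one_le_left
      (div_nonneg hr (T.singularValues_nonneg i)) hR⟩
  refine (measure_mono subset_box).trans_eq ?_
  rw [volume_setOf_abs_repr_le e fun i => mul_nonneg (zero_le_one.trans hR)
    (le_min zero_le_one (div_nonneg hr (T.singularValues_nonneg i)))]
  simp only [← mul_assoc, prod_fin_singularBox]

theorem volume_closedBall_inter_preimage_le_rpow {T : E →ₗ[ℝ] F} (hT : Function.Injective T)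
    {R : ℝ} (hR : 1 ≤ R) {s : ℝ} (hs : 0 ≤ s) (hsn : s ≤ finrank ℝ E) {r : ℝ} (hr : 0 < r) :
    volume (Metric.closedBall 0 R ∩ T ⁻¹' Metric.closedBall 0 r) ≤
      ENNReal.ofReal ((2 * R) ^ finrank ℝ E * (r ^ s / singularValueFunction s T)) := by
  refine (volume_closedBall_inter_preimage_le hT hR hr.le).trans (ENNReal.ofReal_le_ofReal ?_)
  gcongr
  exact singularBoxVolume_le hs hsn hr

theorem le_volume_closedBall_inter_preimage (T : E →ₗ[ℝ] F) {r : ℝ} (hr : 0 ≤ r) :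
    ENNReal.ofReal ((2 / finrank ℝ E) ^ finrank ℝ E * singularBoxVolume T r) ≤
      volume (Metric.closedBall 0 1 ∩ T ⁻¹' Metric.closedBall 0 r) := by
  set n := finrank ℝ E with hn
  obtain ⟨e, norm_map_e, -⟩ := hn ▸ exists_orthonormalBasis_singularValues T
  have side_nonneg (i : Fin n) : 0 ≤ (n : ℝ)⁻¹ * min 1 (r / T.singularValues i) :=
    mul_nonneg (by positivity) (le_min zero_le_one (div_nonneg hr (T.singularValues_nonneg i)))
  have box_subset : {u | ∀ i : Fin n, |e.repr u i| ≤ (n : ℝ)⁻¹ * min 1 (r / T.singularValues i)} ⊆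
      Metric.closedBall 0 1 ∩ T ⁻¹' Metric.closedBall 0 r := by
    intro u hu
    rw [Set.mem_inter_iff, Set.mem_preimage, mem_closedBall_zero_iff, mem_closedBall_zero_iff]
    refine ⟨norm_map_le_of_forall_abs_repr_mul_le e LinearMap.id zero_le_one fun i => ?_,
      norm_map_le_of_forall_abs_repr_mul_le e T hr fun i => ?_⟩
    · rw [LinearMap.id_apply, e.norm_eq_one, mul_one, Fintype.card_fin]
      refine (hu i).trans ?_
      gcongr
      exact min_le_left _ _
    · rw [norm_map_e, Fintype.card_fin]
      calc |e.repr u i| * T.singularValues i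
          ≤ (n : ℝ)⁻¹ * (r / T.singularValues i) * T.singularValues i := by
            refine mul_le_mul_of_nonneg_right ((hu i).trans ?_) (T.singularValues_nonneg i)
            gcongr
            exact min_le_right _ _
        _ ≤ (n : ℝ)⁻¹ * r := by
            rw [mul_assoc]
            gcongr
            rw [div_mul_eq_mul_div, mul_div_assoc]
            exact mul_le_of_le_one_right hr (div_self_le_one _)
  refine le_trans (le_of_eq ?_) (measure_mono box_subset)
  rw [volume_setOf_abs_repr_le e side_nonneg]
  simp only [← mul_assoc, ← div_eq_mul_inv, prod_fin_singularBox, n]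

end Volume

open scoped Pointwise in
/-- Double counting of the pairs `(u, y)` with `u ∈ X` and `y + h u ∈ S`. -/
theorem measure_mul_measure_le_of_addMonoidHom {G H : Type*} [AddCommGroup G] [AddCommGroup H]
    [MeasurableSpace G] [MeasurableSpace H] [MeasurableAdd G] [MeasurableAdd₂ H]
    (μ : Measure G) (ν : Measure H) [SFinite μ] [SFinite ν] [μ.IsAddRightInvariant]
    [ν.IsAddRightInvariant] (h : G →+ H) (hh : Measurable h) {X : Set G} {S : Set H}
    (hX : MeasurableSet X) (hS : MeasurableSet S) :
    μ X * ν S ≤ ν (S - h '' X) * μ ((X - X) ∩ h ⁻¹' (S - S)) := by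
  set Z : Set (G × H) := Prod.fst ⁻¹' X ∩ (fun p => p.2 + h p.1) ⁻¹' S
  have hZ : MeasurableSet Z :=
    (measurable_fst hX).inter ((measurable_snd.add (hh.comp measurable_fst)) hS)
  have measure_fst_section : (μ.prod ν) Z = μ X * ν S := by
    have section_eq (u : G) : ν (Prod.mk u ⁻¹' Z) = X.indicator (fun _ => ν S) u := by
      by_cases hu : u ∈ X
      · rw [Set.indicator_of_mem hu, ← measure_preimage_add_right ν (h u) S]
        congr 1
        ext y
        simp [Z, hu]
      · rw [Set.indicator_of_notMem hu, show Prod.mk u ⁻¹' Z = ∅ by ext y; simp [Z, hu],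
          measure_empty]
    simp only [Measure.prod_apply hZ, section_eq]
    rw [lintegral_indicator_const hX, mul_comm]
  have measure_snd_section_le (y : H) : μ ((fun u => (u, y)) ⁻¹' Z) ≤
      (S - h '' X).indicator (fun _ => μ ((X - X) ∩ h ⁻¹' (S - S))) y := by
    rcases ((fun u => (u, y)) ⁻¹' Z).eq_empty_or_nonempty with h_empty | ⟨u₀, hu₀, hyu₀⟩
    · simp [h_empty]
    · have hy : y ∈ S - h '' X := ⟨_, hyu₀, _, Set.mem_image_of_mem h hu₀, add_sub_cancel_right _ _⟩
      rw [Set.indicator_of_mem hy, ← measure_preimage_add_right μ (-u₀) (_ ∩ _)]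
      refine measure_mono fun u ⟨hu, hyu⟩ => ⟨⟨u, hu, u₀, hu₀, sub_eq_add_neg u u₀⟩,
        ⟨_, hyu, _, hyu₀, ?_⟩⟩
      simp only [map_add, map_neg]
      abel
  rw [← measure_fst_section, Measure.prod_apply_symm hZ, mul_comm]
  exact (lintegral_mono measure_snd_section_le).trans (lintegral_indicator_const_le _ _)

variable {G : Type*} [NormedAddCommGroup G] [InnerProductSpace ℝ G]

theorem volume_mul_volume_le_volume_comp [MeasurableSpace E] [BorelSpace E] [MeasurableSpace F]
    [BorelSpace F] (A : F →ₗ[ℝ] G) (B : E →ₗ[ℝ] F) {a b : ℝ} (hb : 0 < b) :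
    volume (Metric.closedBall 0 1 ∩ B ⁻¹' Metric.closedBall 0 b) *
        volume (Metric.closedBall 0 1 ∩ A ⁻¹' Metric.closedBall 0 a) ≤
      volume (Metric.closedBall (0 : F) 2) *
        volume (Metric.closedBall 0 2 ∩ (A ∘ₗ B) ⁻¹' Metric.closedBall 0 (2 * a * b)) := by
  have hA : Continuous A := A.continuous_of_finiteDimensional
  have hB : Continuous B := B.continuous_of_finiteDimensional
  set X : Set E := Metric.closedBall 0 1 ∩ B ⁻¹' Metric.closedBall 0 b
  set S : Set F := Metric.closedBall 0 1 ∩ A ⁻¹' Metric.closedBall 0 a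
  have hX : MeasurableSet X :=
    (Metric.isClosed_closedBall.inter (Metric.isClosed_closedBall.preimage hB)).measurableSet
  have hS : MeasurableSet S :=
    (Metric.isClosed_closedBall.inter (Metric.isClosed_closedBall.preimage hA)).measurableSet
  refine (measure_mul_measure_le_of_addMonoidHom volume volume (b⁻¹ • B).toAddMonoidHom
    (hB.const_smul b⁻¹).measurable hX hS).trans ?_
  gcongr
  · rintro _ ⟨y, ⟨hy, -⟩, _, ⟨u, ⟨-, hBu⟩, rfl⟩, rfl⟩
    rw [Set.mem_preimage, mem_closedBall_zero_iff] at hBu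
    rw [mem_closedBall_zero_iff] at hy ⊢
    refine (norm_sub_le_of_le hy ?_).trans_eq one_add_one_eq_two
    rw [LinearMap.toAddMonoidHom_coe, LinearMap.smul_apply, norm_smul, norm_inv,
      Real.norm_of_nonneg hb.le]
    exact inv_mul_le_one_of_le₀ hBu hb.le
  · rintro _ ⟨u, ⟨hu, -⟩, u', ⟨hu', -⟩, rfl⟩
    rw [mem_closedBall_zero_iff] at hu hu' ⊢
    exact (norm_sub_le_of_le hu hu').trans_eq one_add_one_eq_two
  · rintro u ⟨y, ⟨-, hy⟩, y', ⟨-, hy'⟩, hyy'⟩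
    rw [Set.mem_preimage, mem_closedBall_zero_iff] at hy hy' ⊢
    have map_eq : (A ∘ₗ B) u = b • (A y - A y') := by
      rw [← map_sub, show y - y' = _ from hyy', LinearMap.toAddMonoidHom_coe,
        LinearMap.smul_apply, map_smul, smul_inv_smul₀ hb.ne', LinearMap.comp_apply]
    rw [map_eq, norm_smul, Real.norm_of_nonneg hb.le, mul_comm b, two_mul]
    exact mul_le_mul_of_nonneg_right (norm_sub_le_of_le hy hy') hb.le

theorem exists_singularValueFunction_comp_le [FiniteDimensional ℝ G] {s : ℝ} (hs : 0 ≤ s)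
    (hsE : s < finrank ℝ E) :
    ∃ K : ℝ, ∀ (A : F →ₗ[ℝ] G) (B : E →ₗ[ℝ] F), Function.Injective A → Function.Injective B →
      singularValueFunction s (A ∘ₗ B) ≤
        K * (singularValueFunction s A * singularValueFunction s B) := by
  borelize E F
  set V : ℝ := volume.real (Metric.closedBall (0 : F) 2)
  set cE : ℝ := (2 / finrank ℝ E) ^ finrank ℝ E
  set cF : ℝ := (2 / finrank ℝ F) ^ finrank ℝ F
  refine ⟨V * (2 * 2) ^ finrank ℝ E * 2 ^ s / (cE * cF), fun A B hA hB => ?_⟩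
  have hsF : s < finrank ℝ F :=
    hsE.trans_le (mod_cast LinearMap.finrank_le_finrank_of_injective hB)
  set a := A.singularValues ⌊s⌋₊
  set b := B.singularValues ⌊s⌋₊
  have ha : 0 < a := singularValues_pos hA ((Nat.floor_lt hs).2 hsF)
  have hb : 0 < b := singularValues_pos hB ((Nat.floor_lt hs).2 hsE)
  have hcE : 0 < cE := pow_pos (div_pos two_pos (hs.trans_lt hsE)) _
  have hcF : 0 < cF := pow_pos (div_pos two_pos (hs.trans_lt hsF)) _
  have hφA := singularValueFunction_pos hA s
  have hφB := singularValueFunction_pos hB s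
  have hφAB := singularValueFunction_pos (T := A ∘ₗ B) (hA.comp hB) s
  have h : cE * (b ^ s / singularValueFunction s B) * (cF * (a ^ s / singularValueFunction s A)) ≤
      V * ((2 * 2) ^ finrank ℝ E * ((2 * a * b) ^ s / singularValueFunction s (A ∘ₗ B))) := by
    rw [← ENNReal.ofReal_le_ofReal_iff (by positivity), ENNReal.ofReal_mul (by positivity),
      ENNReal.ofReal_mul measureReal_nonneg, ofReal_measureReal measure_closedBall_lt_top.ne,
      ← singularBoxVolume_singularValues_floor hB hs hsE,
      ← singularBoxVolume_singularValues_floor hA hs hsF]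
    calc _ ≤ _ := mul_le_mul' (le_volume_closedBall_inter_preimage B hb.le)
          (le_volume_closedBall_inter_preimage A ha.le)
      _ ≤ _ := volume_mul_volume_le_volume_comp A B hb
      _ ≤ _ := mul_le_mul_right (volume_closedBall_inter_preimage_le_rpow
          (T := A ∘ₗ B) (hA.comp hB) one_le_two hs hsE.le (by positivity)) _
  rw [Real.mul_rpow (by positivity) hb.le, Real.mul_rpow two_pos.le ha.le] at h
  have := Real.rpow_pos_of_pos ha s
  have := Real.rpow_pos_of_pos hb s
  field_simp at h ⊢
  exact h

end SingularValues

section Trajectory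

open ProbabilityTheory

variable {J : Type*}

/-- The word formed by the first `n` letters of the sequence `x`. -/
def initialWord (x : ℕ → J) (n : ℕ) : List J :=
  List.ofFn fun k : Fin n => x k

theorem initialWord_succ (x : ℕ → J) (n : ℕ) :
    initialWord x (n + 1) = initialWord x n ++ [x n] := by
  rw [initialWord, List.ofFn_succ', List.concat_eq_append]
  rfl

theorem initialWord_add (x : ℕ → J) (n k : ℕ) :
    initialWord x (n + k) = initialWord x n ++ initialWord (fun j => x (n + j)) k := by
  simp [initialWord, List.ofFn_add]

theorem length_initialWord (x : ℕ → J) (n : ℕ) : (initialWord x n).length = n :=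
  List.length_ofFn

theorem initialWord_eq_iff_mem_cylinder {x y : ℕ → J} {n : ℕ} :
    initialWord y n = initialWord x n ↔ y ∈ PiNat.cylinder x n := by
  simp [initialWord, List.ofFn_inj, funext_iff, Fin.forall_iff]

theorem measurableSet_cylinder [MeasurableSpace J] [DiscreteMeasurableSpace J] (x : ℕ → J)
    (n : ℕ) : MeasurableSet (PiNat.cylinder x n) := by
  rw [PiNat.cylinder_eq_pi]
  exact MeasurableSet.pi (Finset.countable_toSet _) fun _ _ => .of_discrete

theorem map_eval_zero_trajMeasure {X : ℕ → Type*} [∀ n, MeasurableSpace (X n)]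
    (μ₀ : Measure (X 0)) (κ : (n : ℕ) → Kernel (Π i : Finset.Iic n, X i) (X (n + 1)))
    [∀ n, IsMarkovKernel (κ n)] :
    (Kernel.trajMeasure μ₀ κ).map (fun x => x 0) = μ₀ := by
  let eval_zero (y : Π i : Finset.Iic 0, X i) : X 0 := y ⟨0, Finset.mem_Iic.2 le_rfl⟩
  have measurable_eval_zero : Measurable eval_zero := measurable_pi_apply _
  calc (Kernel.trajMeasure μ₀ κ).map (fun x => x 0)
      = ((Kernel.trajMeasure μ₀ κ).map (Preorder.frestrictLe 0)).map eval_zero :=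
        (Measure.map_map measurable_eval_zero (Preorder.measurable_frestrictLe 0)).symm
    _ = (μ₀.map (MeasurableEquiv.piUnique _).symm).map eval_zero := by
        rw [Kernel.trajMeasure, Measure.map_comp _ _ (by fun_prop), Kernel.traj_map_frestrictLe,
          Kernel.partialTraj_self, Measure.id_comp]
    _ = μ₀ := (Measure.map_map measurable_eval_zero (MeasurableEquiv.measurable _)).trans
        Measure.map_id

theorem exists_measure_cylinder_succ [Countable J] [MeasurableSpace J] [DiscreteMeasurableSpace J]
    (p : List J → PMF J) :
    ∃ μ : Measure (ℕ → J), IsProbabilityMeasure μ ∧ ∀ x n,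
      μ (PiNat.cylinder x (n + 1)) = p (initialWord x n) (x n) * μ (PiNat.cylinder x n) := by
  let word (n : ℕ) (y : Finset.Iic n → J) : List J :=
    List.ofFn fun k : Fin (n + 1) => y ⟨k, Finset.mem_Iic.2 (Nat.lt_succ_iff.1 k.2)⟩
  let κ (n : ℕ) : Kernel (Finset.Iic n → J) J :=
    ⟨fun y => (p (word n y)).toMeasure, .of_discrete⟩
  have (n : ℕ) : IsMarkovKernel (κ n) := ⟨fun y => PMF.toMeasure.isProbabilityMeasure _⟩
  set μ : Measure (ℕ → J) := Kernel.trajMeasure (X := fun _ => J) (p []).toMeasure κ with hμ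
  have hμ_prob : IsProbabilityMeasure μ := by rw [hμ]; infer_instance
  refine ⟨μ, hμ_prob, fun x n => ?_⟩
  cases n with
  | zero =>
    have cylinder_one : PiNat.cylinder x 1 = (fun y => y 0) ⁻¹' {x 0} := by
      ext y
      simp
    rw [PiNat.cylinder_zero, measure_univ, mul_one, cylinder_one,
      ← Measure.map_apply (measurable_pi_apply 0) .of_discrete, map_eval_zero_trajMeasure]
    exact PMF.toMeasure_apply_singleton _ _ .of_discrete
  | succ n =>
    have cylinder_eq_preimage : PiNat.cylinder x (n + 1) =
        Preorder.frestrictLe n ⁻¹' {y | word n y = initialWord x (n + 1)} := by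
      ext y
      rw [← initialWord_eq_iff_mem_cylinder]
      rfl
    have cylinder_succ_eq_preimage : PiNat.cylinder x (n + 1 + 1) =
        (fun y => (Preorder.frestrictLe n y, y (n + 1))) ⁻¹'
          ({y | word n y = initialWord x (n + 1)} ×ˢ {x (n + 1)}) := by
      rw [Set.mk_preimage_prod, ← cylinder_eq_preimage]
      ext y
      simp only [PiNat.mem_cylinder_iff, Nat.forall_lt_succ_right (n := n + 1)]
      rfl
    rw [cylinder_succ_eq_preimage,
      ← Measure.map_apply (by fun_prop) (MeasurableSet.of_discrete.prod .of_discrete),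
      ← Kernel.map_frestrictLe_trajMeasure_compProd_eq_map_trajMeasure,
      Measure.compProd_apply_prod .of_discrete .of_discrete,
      setLIntegral_congr_fun (g := fun _ => p (initialWord x (n + 1)) (x (n + 1))) .of_discrete,
      setLIntegral_const, Measure.map_apply (by fun_prop) .of_discrete, ← cylinder_eq_preimage]
    intro y hy
    exact (PMF.toMeasure_apply_singleton _ _ .of_discrete).trans (by rw [hy])

theorem exists_measure_cylinder_eq [Fintype J] [MeasurableSpace J] [DiscreteMeasurableSpace J]
    {m : List J → ℝ≥0∞} (hm_nil : m [] = 1) (hm : ∀ w, m w = ∑ i, m (w ++ [i])) :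
    ∃ μ : Measure (ℕ → J), IsProbabilityMeasure μ ∧
      ∀ x n, μ (PiNat.cylinder x n) = m (initialWord x n) := by
  classical
  have : Nonempty J := by
    by_contra h
    rw [not_nonempty_iff] at h
    simpa [hm_nil] using hm []
  have hm_le_one (w : List J) : m w ≤ 1 := by
    induction w using List.reverseRecOn with
    | nil => exact hm_nil.le
    | append_singleton w i ih =>
      exact ((Finset.single_le_sum (f := fun i => m (w ++ [i])) (fun _ _ => zero_le)
        (Finset.mem_univ i)).trans (hm w).ge).trans ih
  have hm_ne_top (w : List J) : m w ≠ ∞ := ((hm_le_one w).trans_lt ENNReal.one_lt_top).ne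
  have tsum_eq (w : List J) : ∑' i, m (w ++ [i]) = m w := (tsum_fintype _).trans (hm w).symm
  let p (w : List J) : PMF J :=
    if h : m w = 0 then PMF.pure (Classical.arbitrary J)
    else PMF.normalize (fun i => m (w ++ [i])) (by rwa [tsum_eq])
      (by rw [tsum_eq]; exact hm_ne_top w)
  have hp (w : List J) (i : J) : p w i * m w = m (w ++ [i]) := by
    by_cases h : m w = 0
    · rw [h, mul_zero, eq_comm, ← nonpos_iff_eq_zero, ← h, hm w]
      exact Finset.single_le_sum (f := fun i => m (w ++ [i])) (fun _ _ => zero_le)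
        (Finset.mem_univ i)
    · simp only [p, dif_neg h, PMF.normalize_apply, tsum_eq]
      exact ENNReal.inv_mul_cancel_right h (hm_ne_top w)
  obtain ⟨μ, hμ_prob, hμ⟩ := exists_measure_cylinder_succ p
  refine ⟨μ, hμ_prob, fun x n => ?_⟩
  induction n with
  | zero => simp [initialWord, hm_nil]
  | succ n ih => rw [hμ, ih, hp, initialWord_succ]

end Trajectory

section Words

variable {J : Type*} [Fintype J]

/-- The sum of `c` over all words of length `n`. -/
def levelSum (c : List J → ℝ≥0∞) (n : ℕ) : ℝ≥0∞ :=
  ∑ u : Fin n → J, c (List.ofFn u)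

theorem levelSum_zero (c : List J → ℝ≥0∞) : levelSum c 0 = c [] := by
  simp [levelSum]

theorem levelSum_add (c : List J → ℝ≥0∞) (m n : ℕ) :
    levelSum c (m + n) = ∑ u : Fin m → J, levelSum (fun w => c (List.ofFn u ++ w)) n := by
  simp only [levelSum, ← Fintype.sum_prod_type']
  exact (Fintype.sum_equiv (Fin.appendEquiv m n) _ _ fun p => by
    rw [← List.ofFn_fin_append]; rfl).symm

theorem levelSum_succ (c : List J → ℝ≥0∞) (n : ℕ) :
    levelSum c (n + 1) = ∑ i, levelSum (fun w => c (i :: w)) n := by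
  simp only [levelSum, ← Fintype.sum_prod_type']
  exact (Fintype.sum_equiv (Fin.consEquiv fun _ => J) _ _ fun p => by
    simp [List.ofFn_succ]).symm

theorem levelSum_append_le {c : List J → ℝ≥0∞} {K : ℝ≥0∞}
    (hc : ∀ u v, c (u ++ v) ≤ K * (c u * c v)) (w : List J) (n : ℕ) :
    levelSum (fun u => c (w ++ u)) n ≤ K * c w * levelSum c n := by
  rw [levelSum, levelSum, Finset.mul_sum]
  exact Finset.sum_le_sum fun u _ => (hc w _).trans_eq (mul_assoc _ _ _).symm

theorem levelSum_add_le {c : List J → ℝ≥0∞} {K : ℝ≥0∞}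
    (hc : ∀ u v, c (u ++ v) ≤ K * (c u * c v)) (m n : ℕ) :
    levelSum c (m + n) ≤ K * levelSum c m * levelSum c n := by
  rw [levelSum_add, levelSum, Finset.mul_sum, Finset.sum_mul]
  exact Finset.sum_le_sum fun u _ => levelSum_append_le hc _ n

/-- The sum of `c` over all extensions of the word `w` by fewer than `N` letters. -/
def extensionSum (c : List J → ℝ≥0∞) (N : ℕ) (w : List J) : ℝ≥0∞ :=
  ∑ n ∈ Finset.range N, levelSum (fun u => c (w ++ u)) n

theorem extensionSum_succ (c : List J → ℝ≥0∞) (N : ℕ) (w : List J) :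
    extensionSum c (N + 1) w = c w + ∑ i, extensionSum c N (w ++ [i]) := by
  simp only [extensionSum, Finset.sum_range_succ', levelSum_zero, levelSum_succ, List.append_nil,
    List.append_assoc, List.singleton_append]
  rw [Finset.sum_comm, add_comm]

theorem extensionSum_le {c : List J → ℝ≥0∞} {K : ℝ≥0∞}
    (hc : ∀ u v, c (u ++ v) ≤ K * (c u * c v)) (N : ℕ) (w : List J) :
    extensionSum c N w ≤ K * c w * extensionSum c N [] := by
  rw [extensionSum, extensionSum, Finset.mul_sum]
  exact Finset.sum_le_sum fun n _ => levelSum_append_le hc w n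

theorem extensionSum_mono (c : List J → ℝ≥0∞) (w : List J) :
    Monotone fun N => extensionSum c N w :=
  fun _ _ h => Finset.sum_le_sum_of_subset (Finset.range_mono h)

theorem extensionSum_ne_top {c : List J → ℝ≥0∞} (hc : ∀ w, c w ≠ ∞) (N : ℕ) (w : List J) :
    extensionSum c N w ≠ ∞ :=
  ENNReal.sum_ne_top.2 fun _ _ => ENNReal.sum_ne_top.2 fun _ _ => hc _

theorem tendsto_extensionSum_nil (c : List J → ℝ≥0∞) :
    Tendsto (fun N => extensionSum c N []) atTop (𝓝 (∑' n, levelSum c n)) :=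
  ENNReal.summable.hasSum.tendsto_sum_nat

/-- The share of the words shorter than `N` that extend `w`, each word `u` counted with weight
`c u`. -/
def extensionShare (c : List J → ℝ≥0∞) (N : ℕ) (w : List J) : ℝ≥0∞ :=
  extensionSum c (N - w.length) w / extensionSum c N []

theorem extensionShare_eq_add_sum (c : List J → ℝ≥0∞) {N : ℕ} {w : List J} (hw : w.length < N) :
    extensionShare c N w =
      c w / extensionSum c N [] + ∑ i, extensionShare c N (w ++ [i]) := by
  obtain ⟨M, rfl⟩ := Nat.exists_eq_add_of_lt hw
  simp only [extensionShare, List.length_append, List.length_singleton, div_eq_mul_inv,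
    ← Finset.sum_mul, ← add_mul]
  rw [show w.length + M + 1 - w.length = M + 1 by omega,
    show w.length + M + 1 - (w.length + 1) = M by omega, extensionSum_succ]

theorem extensionShare_le {c : List J → ℝ≥0∞} {K : ℝ≥0∞}
    (hc : ∀ u v, c (u ++ v) ≤ K * (c u * c v)) (N : ℕ) (w : List J) :
    extensionShare c N w ≤ K * c w := by
  calc extensionShare c N w
      ≤ K * c w * extensionSum c N [] / extensionSum c N [] := by
        refine ENNReal.div_le_div_right ((extensionSum_le hc _ w).trans ?_) _
        gcongr
        exact extensionSum_mono c [] (Nat.sub_le N w.length)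
    _ ≤ K * c w := by
        rw [mul_div_assoc]
        exact mul_le_of_le_one_right' ENNReal.div_self_le_one

/-- A limit of the shares `extensionShare c N` is an additive function of cylinders: the
defect `c w / extensionSum c N []` disappears since the series of the level sums diverges. -/
theorem exists_additive_le_of_tsum_levelSum_eq_top {c : List J → ℝ≥0∞} {K : ℝ≥0∞}
    (hc_top : ∀ w, c w ≠ ∞) (hc : ∀ u v, c (u ++ v) ≤ K * (c u * c v))
    (hc_sum : ∑' n, levelSum c n = ∞) :
    ∃ m : List J → ℝ≥0∞, m [] = 1 ∧ (∀ w, m w = ∑ i, m (w ++ [i])) ∧ ∀ w, m w ≤ K * c w := by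
  have total_tendsto : Tendsto (fun N => extensionSum c N []) (hyperfilter ℕ) (𝓝 ∞) :=
    (hc_sum ▸ tendsto_extensionSum_nil c).mono_left Nat.hyperfilter_le_atTop
  obtain ⟨m, -, hm⟩ := isCompact_univ.ultrafilter_le_nhds
    ((hyperfilter ℕ).map (extensionShare c)) (by simp)
  have share_tendsto (w : List J) :
      Tendsto (fun N => extensionShare c N w) (hyperfilter ℕ) (𝓝 (m w)) :=
    tendsto_pi_nhds.1 hm w
  refine ⟨m, ?_, fun w => ?_, fun w => ?_⟩
  · refine tendsto_nhds_unique (share_tendsto []) (tendsto_const_nhds.congr' ?_)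
    filter_upwards [total_tendsto.eventually (lt_mem_nhds ENNReal.zero_lt_top)] with N hN
    exact (ENNReal.div_self hN.ne' (extensionSum_ne_top hc_top N [])).symm
  · have defect_tendsto : Tendsto (fun N => c w / extensionSum c N []) (hyperfilter ℕ) (𝓝 0) := by
      simpa using ENNReal.Tendsto.const_div total_tendsto (Or.inr (hc_top w))
    have sum_tendsto := defect_tendsto.add
      (tendsto_finsetSum Finset.univ fun i _ => share_tendsto (w ++ [i]))
    rw [zero_add] at sum_tendsto
    refine tendsto_nhds_unique (share_tendsto w) (sum_tendsto.congr' ?_)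
    filter_upwards [Nat.hyperfilter_le_atTop (eventually_gt_atTop w.length)] with N hN
    exact (extensionShare_eq_add_sum c hN).symm
  · exact le_of_tendsto' (share_tendsto w) fun N => extensionShare_le hc N w

theorem exists_measure_cylinder_le [MeasurableSpace J] [DiscreteMeasurableSpace J]
    {c : List J → ℝ≥0∞} {K : ℝ≥0∞} (hc_top : ∀ w, c w ≠ ∞)
    (hc : ∀ u v, c (u ++ v) ≤ K * (c u * c v)) (hc_sum : ∑' n, levelSum c n = ∞) :
    ∃ μ : Measure (ℕ → J), IsProbabilityMeasure μ ∧
      ∀ x n, μ (PiNat.cylinder x n) ≤ K * c (initialWord x n) := by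
  obtain ⟨m, m_nil, m_additive, m_le⟩ := exists_additive_le_of_tsum_levelSum_eq_top hc_top hc hc_sum
  obtain ⟨μ, μ_prob, hμ⟩ := exists_measure_cylinder_eq m_nil m_additive
  exact ⟨μ, μ_prob, fun x n => (hμ x n).trans_le (m_le _)⟩

end Words

section Submultiplicative

theorem le_pow_of_submultiplicative {b : ℕ → ℝ≥0∞} {ε : ℝ≥0∞} {n₀ : ℕ}
    (hb : ∀ m n, b (m + n) ≤ b m * b n) (hε : ∀ n, n₀ ≤ n → b n ≤ ε) (q : ℕ) {n : ℕ}
    (hn : (q + 1) * n₀ ≤ n) : b n ≤ ε ^ (q + 1) := by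
  induction q generalizing n with
  | zero => simpa using hε n (by simpa using hn)
  | succ q ih =>
    obtain ⟨k, rfl⟩ : ∃ k, n = n₀ + k := Nat.exists_eq_add_of_le (by nlinarith)
    calc b (n₀ + k) ≤ b n₀ * b k := hb _ _
      _ ≤ ε * ε ^ (q + 1) := by
        gcongr
        exacts [hε n₀ le_rfl, ih (by nlinarith)]
      _ = ε ^ (q + 1 + 1) := (pow_succ' _ _).symm

theorem exists_eventually_le_pow_of_submultiplicative {b : ℕ → ℝ≥0∞}
    (hb : ∀ m n, b (m + n) ≤ b m * b n) (hb_lim : Tendsto b atTop (𝓝 0)) :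
    ∃ ρ < 1, ∀ᶠ n in atTop, b n ≤ ρ ^ n := by
  obtain ⟨n₀, hn₀⟩ := eventually_atTop.1
    (hb_lim.eventually (ge_mem_nhds (ENNReal.inv_pos.2 ENNReal.ofNat_ne_top : 0 < (2 : ℝ≥0∞)⁻¹)))
  set k := n₀ + 1
  have two_k_ne_zero : ((2 * k : ℕ) : ℝ) ≠ 0 := by positivity
  set ρ : ℝ≥0∞ := 2⁻¹ ^ ((2 * k : ℕ) : ℝ)⁻¹
  have ρ_lt_one : ρ < 1 :=
    ENNReal.rpow_lt_one (ENNReal.inv_lt_one.2 ENNReal.one_lt_two) (by positivity)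
  have ρ_pow : ρ ^ (2 * k) = 2⁻¹ := by
    rw [← ENNReal.rpow_natCast, ← ENNReal.rpow_mul, inv_mul_cancel₀ two_k_ne_zero,
      ENNReal.rpow_one]
  refine ⟨ρ, ρ_lt_one, (eventually_ge_atTop k).mono fun n hn => ?_⟩
  obtain ⟨q, hq⟩ := Nat.exists_eq_add_of_le' (Nat.div_pos hn n₀.succ_pos)
  have n_lt : n < (q + 1 + 1) * k := hq ▸ Nat.lt_mul_of_div_lt (Nat.lt_succ_self _) n₀.succ_pos
  calc b n ≤ 2⁻¹ ^ (q + 1) := le_pow_of_submultiplicative hb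
        (fun n hn => hn₀ n (by omega)) q (hq ▸ Nat.div_mul_le_self n k)
    _ = ρ ^ (2 * k * (q + 1)) := by rw [pow_mul, ρ_pow]
    _ ≤ ρ ^ n := pow_le_pow_right_of_le_one' ρ_lt_one.le (by nlinarith)

theorem limsup_log_div_neg {a : ℕ → ℝ≥0∞} {ρ : ℝ≥0∞} (hρ : ρ < 1)
    (ha : ∀ᶠ n in atTop, a n ≤ ρ ^ n) :
    limsup (fun n : ℕ => ENNReal.log (a n) / (n : EReal)) atTop < 0 := by
  refine lt_of_le_of_lt ?_ (ENNReal.log_lt_zero_iff.2 hρ)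
  refine limsup_le_of_le (by isBoundedDefault) ?_
  filter_upwards [ha, eventually_gt_atTop 0] with n hn n_pos
  rw [EReal.div_le_iff_le_mul (by exact_mod_cast n_pos) (EReal.natCast_ne_top n)]
  exact (ENNReal.log_monotone hn).trans_eq (by rw [ENNReal.log_pow, mul_comm])

theorem tsum_levelSum_eq_top_of_limsup_log_div_nonneg {J : Type*} [Fintype J]
    {c : List J → ℝ≥0∞} {K : ℝ≥0∞}
    (hK : 1 ≤ K) (hK_top : K ≠ ∞) (hc : ∀ u v, c (u ++ v) ≤ K * (c u * c v))
    (h : 0 ≤ limsup (fun n : ℕ => ENNReal.log (levelSum c n) / (n : EReal)) atTop) :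
    ∑' n, levelSum c n = ∞ := by
  by_contra h_sum
  have level_tendsto := ENNReal.Tendsto.const_mul (a := K)
    (ENNReal.tendsto_atTop_zero_of_tsum_ne_top h_sum) (Or.inr hK_top)
  rw [mul_zero] at level_tendsto
  obtain ⟨ρ, hρ, level_le⟩ := exists_eventually_le_pow_of_submultiplicative (fun m n =>
    (mul_le_mul_right (levelSum_add_le hc m n) K).trans_eq (by ring)) level_tendsto
  exact h.not_gt (limsup_log_div_neg hρ (level_le.mono fun n hn =>
    (le_mul_of_one_le_left' hK).trans hn))

end Submultiplicative

section Coding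

variable {J V : Type*} [NormedAddCommGroup V] [NormedSpace ℝ V] {L : J → V →L[ℝ] V} {α : ℝ≥0}

/-- The product `L_{i_1} ⋯ L_{i_n}` for the word `w = (i_1, …, i_n)`. -/
def wordOperator (L : J → V →L[ℝ] V) (w : List J) : V →L[ℝ] V :=
  (w.map L).prod

theorem wordOperator_append_apply (w w' : List J) (u : V) :
    wordOperator L (w ++ w') u = wordOperator L w (wordOperator L w' u) := by
  simp [wordOperator]

theorem wordOperator_injective (hL : ∀ i, Function.Injective (L i)) (w : List J) :
    Function.Injective (wordOperator L w) := by
  induction w with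
  | nil => exact Function.injective_id
  | cons i w ih => simpa [wordOperator] using (hL i).comp ih

theorem norm_wordOperator_le (hL : ∀ i, ‖L i‖ ≤ α) (w : List J) :
    ‖wordOperator L w‖ ≤ α ^ w.length := by
  induction w with
  | nil => exact ContinuousLinearMap.norm_id_le.trans_eq (pow_zero _).symm
  | cons i w ih =>
    rw [wordOperator, List.map_cons, List.prod_cons, List.length_cons, pow_succ']
    exact (norm_mul_le _ _).trans (mul_le_mul (hL i) ih (norm_nonneg _) α.2)

theorem norm_wordOperator_initialWord_apply_le (hL : ∀ i, ‖L i‖ ≤ α) (x : ℕ → J) (k : ℕ)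
    (u : V) : ‖wordOperator L (initialWord x k) u‖ ≤ α ^ k * ‖u‖ := by
  simpa only [length_initialWord] using
    (wordOperator L _).le_of_opNorm_le (norm_wordOperator_le hL (initialWord x k)) u

/-- The limit of `T_{x 0} ∘ ⋯ ∘ T_{x (n - 1)}` as `n → ∞`, where `T_i u = L i u + v i`: the point
with address `x` of the attractor of the system `(T_i)`. -/
def codingMap (L : J → V →L[ℝ] V) (v : J → V) (x : ℕ → J) : V :=
  ∑' k, wordOperator L (initialWord x k) (v (x k))

theorem iterComp_apply_eq_add_sum (v : J → V) (x : ℕ → J) (n : ℕ) (u : V) :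
    iterComp (fun k u => L (x k) u + v (x k)) n u = wordOperator L (initialWord x n) u +
      ∑ k ∈ Finset.range n, wordOperator L (initialWord x k) (v (x k)) := by
  induction n generalizing u with
  | zero => simp [iterComp, initialWord, wordOperator]
  | succ n ih =>
    rw [iterComp, Function.comp_apply, ih, map_add, Finset.sum_range_succ, initialWord_succ,
      wordOperator_append_apply]
    simp only [wordOperator, List.map_singleton, List.prod_singleton]
    abel

theorem norm_codingMap_term_le (hL : ∀ i, ‖L i‖ ≤ α) {v : J → V} {M : ℝ} (hM : ∀ i, ‖v i‖ ≤ M)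
    (x : ℕ → J) (k : ℕ) : ‖wordOperator L (initialWord x k) (v (x k))‖ ≤ α ^ k * M :=
  (norm_wordOperator_initialWord_apply_le hL x k _).trans
    (mul_le_mul_of_nonneg_left (hM (x k)) (by positivity))

theorem norm_codingMap_le (hL : ∀ i, ‖L i‖ ≤ α) (hα : α < 1) {v : J → V} {M : ℝ}
    (hM : ∀ i, ‖v i‖ ≤ M) (x : ℕ → J) : ‖codingMap L v x‖ ≤ (1 - (α : ℝ))⁻¹ * M :=
  tsum_of_norm_bounded ((hasSum_geometric_of_lt_one α.2 hα).mul_right M)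
    (norm_codingMap_term_le hL hM x)

section Finite

variable [Finite J] [CompleteSpace V]

theorem summable_codingMap (hL : ∀ i, ‖L i‖ ≤ α) (hα : α < 1) (v : J → V) (x : ℕ → J) :
    Summable fun k => wordOperator L (initialWord x k) (v (x k)) := by
  obtain ⟨M, hM⟩ := (Set.finite_range fun i => ‖v i‖).bddAbove
  exact .of_norm_bounded ((summable_geometric_of_lt_one α.2 hα).mul_right M)
    (norm_codingMap_term_le hL (fun i => hM ⟨i, rfl⟩) x)

theorem tendsto_iterComp_codingMap (hL : ∀ i, ‖L i‖ ≤ α) (hα : α < 1) (v : J → V) (x : ℕ → J)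
    (u : V) : Tendsto (fun n => iterComp (fun k u => L (x k) u + v (x k)) n u) atTop
      (𝓝 (codingMap L v x)) := by
  have contraction : Tendsto (fun n => wordOperator L (initialWord x n) u) atTop (𝓝 0) :=
    squeeze_zero_norm (fun n => norm_wordOperator_initialWord_apply_le hL x n u)
      (by simpa using (tendsto_pow_atTop_nhds_zero_of_lt_one α.2 hα).mul_const ‖u‖)
  simpa only [iterComp_apply_eq_add_sum, zero_add, codingMap] using
    contraction.add (summable_codingMap hL hα v x).hasSum.tendsto_sum_nat

theorem codingMap_eq_sum_add (hL : ∀ i, ‖L i‖ ≤ α) (hα : α < 1) (v : J → V) (x : ℕ → J)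
    (n : ℕ) :
    codingMap L v x = ∑ k ∈ Finset.range n, wordOperator L (initialWord x k) (v (x k)) +
      wordOperator L (initialWord x n) (codingMap L v fun j => x (n + j)) := by
  rw [codingMap, ← (summable_codingMap hL hα v x).sum_add_tsum_nat_add n, codingMap,
    (wordOperator L _).map_tsum (summable_codingMap hL hα v _)]
  congr 1
  refine tsum_congr fun k => ?_
  rw [add_comm k n, initialWord_add, wordOperator_append_apply]

theorem codingMap_sub_codingMap_of_mem_cylinder (hL : ∀ i, ‖L i‖ ≤ α) (hα : α < 1) (v : J → V)
    {x y : ℕ → J} {n : ℕ} (hy : y ∈ PiNat.cylinder x n) :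
    codingMap L v x - codingMap L v y = wordOperator L (initialWord x n)
      (codingMap L v (fun j => x (n + j)) - codingMap L v fun j => y (n + j)) := by
  have common_sum : ∑ k ∈ Finset.range n, wordOperator L (initialWord y k) (v (y k)) =
      ∑ k ∈ Finset.range n, wordOperator L (initialWord x k) (v (x k)) :=
    Finset.sum_congr rfl fun k hk => by
      have hk := Finset.mem_range.1 hk
      rw [hy k hk, initialWord_eq_iff_mem_cylinder.2 (PiNat.cylinder_anti x hk.le hy)]
  rw [codingMap_eq_sum_add hL hα v x n, codingMap_eq_sum_add hL hα v y n, common_sum,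
    initialWord_eq_iff_mem_cylinder.2 hy, map_sub, add_sub_add_left_eq_sub]

theorem codingMap_sub (hL : ∀ i, ‖L i‖ ≤ α) (hα : α < 1) (v v' : J → V) (x : ℕ → J) :
    codingMap L (v - v') x = codingMap L v x - codingMap L v' x := by
  simp only [codingMap, Pi.sub_apply, map_sub]
  exact (summable_codingMap hL hα v x).tsum_sub (summable_codingMap hL hα v' x)

theorem measurable_codingMap [MeasurableSpace J] [DiscreteMeasurableSpace J] [MeasurableSpace V]
    [BorelSpace V] [SecondCountableTopology V] (hL : ∀ i, ‖L i‖ ≤ α) (hα : α < 1) :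
    Measurable fun p : (J → V) × (ℕ → J) => codingMap L p.1 p.2 := by
  have term_measurable (k : ℕ) : Measurable fun p : (J → V) × (ℕ → J) =>
      wordOperator L (initialWord p.2 k) (p.1 (p.2 k)) := by
    have : Measurable fun q : (J → V) × (Fin (k + 1) → J) =>
        wordOperator L (List.ofFn fun j : Fin k => q.2 j.castSucc) (q.1 (q.2 (Fin.last k))) :=
      measurable_from_prod_countable_left fun u =>
        (wordOperator L (List.ofFn fun j : Fin k => u j.castSucc)).measurable.comp
          (measurable_pi_apply (u (Fin.last k)))
    have restrict_measurable : Measurable fun (x : ℕ → J) (j : Fin (k + 1)) => x j :=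
      measurable_pi_lambda _ fun j => measurable_pi_apply (j : ℕ)
    exact this.comp (measurable_fst.prodMk (restrict_measurable.comp measurable_snd))
  exact measurable_of_tendsto_metrizable
    (fun n => Finset.measurable_fun_sum (Finset.range n) fun k _ => term_measurable k)
    (tendsto_pi_nhds.2 fun p => (summable_codingMap hL hα p.1 p.2).hasSum.tendsto_sum_nat)

theorem measurable_edist_codingMap_rpow [MeasurableSpace J]
    [DiscreteMeasurableSpace J] [MeasurableSpace V] [BorelSpace V] [SecondCountableTopology V]
    (hL_norm : ∀ i, ‖L i‖ ≤ α) (hα : α < 1) (τ : ℝ) :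
    Measurable fun p : ((J → V) × (ℕ → J)) × (ℕ → J) =>
      edist (codingMap L p.1.1 p.1.2) (codingMap L p.1.1 p.2) ^ τ := by
  have codingMap_measurable := measurable_codingMap hL_norm hα
  exact ((codingMap_measurable.comp measurable_fst).edist (codingMap_measurable.comp
    ((measurable_fst.comp measurable_fst).prodMk measurable_snd))).pow_const τ

end Finite

end Coding

section Transversality

variable {J V : Type*} [NormedAddCommGroup V] [NormedSpace ℝ V] {L : J → V →L[ℝ] V} {α : ℝ≥0}

/-- The sum of `α ^ k` over the positions `k` at which `x` has the letter `l`. -/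
def letterWeight (α : ℝ≥0) (x : ℕ → J) (l : J) : ℝ :=
  ∑' k, (x ⁻¹' {l}).indicator (fun k => (α : ℝ) ^ k) k

theorem summable_letterWeight (hα : α < 1) (x : ℕ → J) (l : J) :
    Summable ((x ⁻¹' {l}).indicator fun k => (α : ℝ) ^ k) :=
  (summable_geometric_of_lt_one α.2 hα).indicator _

theorem letterWeight_add_letterWeight_le (hα : α < 1) (x : ℕ → J) {i j : J} (hij : i ≠ j) :
    letterWeight α x i + letterWeight α x j ≤ (1 - (α : ℝ))⁻¹ := by
  have disjoint_preimages : Disjoint (x ⁻¹' {i}) (x ⁻¹' {j}) :=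
    (Set.disjoint_singleton.2 hij).preimage x
  rw [letterWeight, letterWeight,
    ← (summable_letterWeight hα x i).tsum_add (summable_letterWeight hα x j),
    ← tsum_geometric_of_lt_one α.coe_nonneg hα]
  simp only [← Set.indicator_union_of_disjoint disjoint_preimages]
  have geometric := summable_geometric_of_lt_one α.2 hα
  exact (geometric.indicator _).tsum_le_tsum
    (Set.indicator_le_self' fun k _ => by positivity) geometric

theorem norm_codingMap_single_le [DecidableEq J] (hL : ∀ i, ‖L i‖ ≤ α) (hα : α < 1) (x : ℕ → J)
    (l : J) (u : V) : ‖codingMap L (Pi.single l u) x‖ ≤ letterWeight α x l * ‖u‖ := by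
  refine tsum_of_norm_bounded ((summable_letterWeight hα x l).hasSum.mul_right ‖u‖) fun k => ?_
  by_cases hk : x k = l
  · subst hk
    simpa using norm_wordOperator_initialWord_apply_le hL x k u
  · simp [hk]

theorem letterWeight_head (hα : α < 1) (x : ℕ → J) :
    letterWeight α x (x 0) = 1 + α * letterWeight α (fun j => x (1 + j)) (x 0) := by
  rw [letterWeight, (summable_letterWeight hα x (x 0)).tsum_eq_zero_add, letterWeight,
    ← tsum_mul_left]
  refine congrArg₂ (· + ·) (by simp) (tsum_congr fun k => ?_)
  by_cases hk : x (k + 1) = x 0 <;> simp [hk, add_comm 1 k, pow_succ']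

variable [Finite J] [CompleteSpace V]

theorem norm_codingMap_single_sub_le [DecidableEq J] (hL : ∀ i, ‖L i‖ ≤ α) (hα : α < 1)
    (x : ℕ → J) (u : V) :
    ‖codingMap L (Pi.single (x 0) u) x - u‖ ≤ (letterWeight α x (x 0) - 1) * ‖u‖ := by
  have map_split : codingMap L (Pi.single (x 0) u) x - u =
      L (x 0) (codingMap L (Pi.single (x 0) u) fun j => x (1 + j)) := by
    rw [codingMap_eq_sum_add hL hα _ x 1]
    simp [initialWord, wordOperator]
  rw [map_split, letterWeight_head hα, add_sub_cancel_left, mul_assoc]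
  exact (L (x 0)).le_of_opNorm_le_of_le (hL _) (norm_codingMap_single_le hL hα _ _ u)

theorem le_norm_codingMap_single_sub [DecidableEq J] (hL : ∀ i, ‖L i‖ ≤ α) (hα : α < 1)
    (x y : ℕ → J) (u : V) :
    (2 - (letterWeight α x (x 0) + letterWeight α y (x 0))) * ‖u‖ ≤
      ‖codingMap L (Pi.single (x 0) u) x - codingMap L (Pi.single (x 0) u) y‖ := by
  have hx := norm_codingMap_single_sub_le hL hα x u
  have hy := norm_codingMap_single_le hL hα y (x 0) u
  have triangle := norm_le_norm_add_norm_sub'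
    u (codingMap L (Pi.single (x 0) u) x)
  have triangle' := norm_sub_norm_le
    (codingMap L (Pi.single (x 0) u) x) (codingMap L (Pi.single (x 0) u) y)
  rw [norm_sub_rev] at triangle
  linarith

theorem antilipschitzWith_codingMap_update_sub [DecidableEq J] (hL : ∀ i, ‖L i‖ ≤ α)
    (hα : α < 1 / 2) {x y : ℕ → J} {l : J}
    (hl : ∀ u, (2 - (1 - (α : ℝ))⁻¹) * ‖u‖ ≤
      ‖codingMap L (Pi.single l u) x - codingMap L (Pi.single l u) y‖) (v : J → V) :
    AntilipschitzWith (2 - (1 - α)⁻¹)⁻¹ fun a =>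
      codingMap L (Function.update v l a) x - codingMap L (Function.update v l a) y := by
  have hα_one : α < 1 := hα.trans (NNReal.half_lt_self one_ne_zero)
  have inv_lt_two : (1 - α)⁻¹ < 2 := by
    rwa [inv_lt_comm₀ (tsub_pos_of_lt hα_one) two_pos, lt_tsub_comm,
      tsub_eq_of_eq_add (show (1 : ℝ≥0) = 1 / 2 + 2⁻¹ by norm_num)]
  have coe_eq : ((2 - (1 - α)⁻¹ : ℝ≥0) : ℝ) = 2 - (1 - (α : ℝ))⁻¹ := by
    rw [NNReal.coe_sub inv_lt_two.le, NNReal.coe_inv, NNReal.coe_sub hα_one.le]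
    norm_num
  refine .of_le_mul_dist fun a a' => ?_
  have update_sub_update : Function.update v l a - Function.update v l a' =
      Pi.single l (a - a') := by
    rw [← Function.update_sub, sub_self]
    rfl
  rw [dist_eq_norm, dist_eq_norm, NNReal.coe_inv, le_inv_mul_iff₀ (by simpa using inv_lt_two),
    coe_eq, sub_sub_sub_comm, ← codingMap_sub hL hα_one, ← codingMap_sub hL hα_one,
    update_sub_update]
  exact hl _

/-- Besides the leading terms, the letters `x 0` and `y 0` have total weight at most
`2 / (1 - α) - 2` in `x` and `y`, so for one of them the leading term dominates the others. -/
theorem exists_antilipschitzWith_codingMap_update_sub [DecidableEq J] (hL : ∀ i, ‖L i‖ ≤ α)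
    (hα : α < 1 / 2) {x y : ℕ → J} (hxy : x 0 ≠ y 0) :
    ∃ l, ∀ v : J → V, AntilipschitzWith (2 - (1 - α)⁻¹)⁻¹ fun a =>
      codingMap L (Function.update v l a) x - codingMap L (Function.update v l a) y := by
  have hα_one : α < 1 := hα.trans (NNReal.half_lt_self one_ne_zero)
  have hx := letterWeight_add_letterWeight_le hα_one x hxy
  have hy := letterWeight_add_letterWeight_le hα_one y hxy
  rcases le_total (letterWeight α x (x 0) + letterWeight α y (x 0)) (1 - (α : ℝ))⁻¹ with h | h
  · refine ⟨x 0, antilipschitzWith_codingMap_update_sub hL hα fun u => ?_⟩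
    refine le_trans ?_ (le_norm_codingMap_single_sub hL hα_one x y u)
    gcongr
  · refine ⟨y 0, antilipschitzWith_codingMap_update_sub hL hα fun u => ?_⟩
    rw [norm_sub_rev]
    refine le_trans ?_ (le_norm_codingMap_single_sub hL hα_one y x u)
    gcongr
    linarith

end Transversality

section SingularWeight

open Module

variable {J E : Type*} [NormedAddCommGroup E] [InnerProductSpace ℝ E] [FiniteDimensional ℝ E]

/-- The weight `φ^s(L_{i_1} ⋯ L_{i_n})` of the word `(i_1, …, i_n)`. -/
def singularWeight (L : J → E →L[ℝ] E) (s : ℝ) (w : List J) : ℝ≥0∞ :=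
  ENNReal.ofReal (singularValueFunction s (wordOperator L w : E →ₗ[ℝ] E))

theorem singularWeight_ne_top (L : J → E →L[ℝ] E) (s : ℝ) (w : List J) :
    singularWeight L s w ≠ ∞ :=
  ENNReal.ofReal_ne_top

theorem singularWeight_ne_zero {L : J → E →L[ℝ] E} (hL : ∀ i, Function.Injective (L i)) (s : ℝ)
    (w : List J) : singularWeight L s w ≠ 0 :=
  (ENNReal.ofReal_pos.2 (singularValueFunction_pos (wordOperator_injective hL w) s)).ne'

theorem singularWeight_zero (L : J → E →L[ℝ] E) (w : List J) : singularWeight L 0 w = 1 := by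
  rw [singularWeight, singularValueFunction_zero, ENNReal.ofReal_one]

theorem exists_singularWeight_append_le {L : J → E →L[ℝ] E} (hL : ∀ i, Function.Injective (L i))
    {s : ℝ} (hs : 0 ≤ s) (hsE : s < finrank ℝ E) :
    ∃ K : ℝ≥0∞, 1 ≤ K ∧ K ≠ ∞ ∧ ∀ u v : List J,
      singularWeight L s (u ++ v) ≤ K * (singularWeight L s u * singularWeight L s v) := by
  obtain ⟨K, hK⟩ := exists_singularValueFunction_comp_le (E := E) (F := E) (G := E) hs hsE
  refine ⟨ENNReal.ofReal (max 1 K), by simp, ENNReal.ofReal_ne_top, fun u v => ?_⟩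
  have hu := wordOperator_injective hL u
  have hv := wordOperator_injective hL v
  have φu_pos := singularValueFunction_pos hu s
  have φv_pos := singularValueFunction_pos hv s
  simp only [singularWeight]
  rw [← ENNReal.ofReal_mul φu_pos.le, ← ENNReal.ofReal_mul (by positivity), wordOperator,
    List.map_append, List.prod_append]
  refine ENNReal.ofReal_le_ofReal ((hK _ _ hu hv).trans ?_)
  gcongr
  exact le_max_right 1 K

theorem singularWeight_le_rpow_mul {L : J → E →L[ℝ] E} (hL : ∀ i, Function.Injective (L i))
    {α : ℝ≥0} (hα_pos : 0 < α) (hα : ∀ i, ‖L i‖ ≤ α) {s t : ℝ} (ht : 0 ≤ t) (hts : t ≤ s)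
    (hs : s ≤ finrank ℝ E) (w : List J) :
    singularWeight L s w ≤ (α ^ (s - t)) ^ w.length * singularWeight L t w := by
  have pow_pos : (0 : ℝ) < α ^ w.length := pow_pos hα_pos _
  have main := singularValueFunction_le_rpow_mul (wordOperator_injective hL w) pow_pos
    ((wordOperator L w).le_of_opNorm_le (norm_wordOperator_le hα w)) ht hts hs
  calc singularWeight L s w
      ≤ ENNReal.ofReal (((α : ℝ) ^ w.length) ^ (s - t)) * singularWeight L t w :=
        (ENNReal.ofReal_le_ofReal main).trans_eq (ENNReal.ofReal_mul (by positivity))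
    _ = (α ^ (s - t)) ^ w.length * singularWeight L t w := by
        rw [← ENNReal.ofReal_rpow_of_pos pow_pos, ENNReal.ofReal_pow α.coe_nonneg,
          ENNReal.ofReal_coe_nnreal, ← ENNReal.rpow_natCast_mul, mul_comm (w.length : ℝ),
          ENNReal.rpow_mul_natCast]

theorem singularWeight_le_one {L : J → E →L[ℝ] E} (hL : ∀ i, Function.Injective (L i))
    (hL_norm : ∀ i, ‖L i‖ ≤ 1) {s : ℝ} (hs : 0 ≤ s) (hsE : s ≤ finrank ℝ E) (w : List J) :
    singularWeight L s w ≤ 1 := by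
  simpa [singularWeight_zero] using
    singularWeight_le_rpow_mul hL one_pos hL_norm le_rfl hs hsE w

theorem volume_closedBall_inter_preimage_wordOperator_le [MeasurableSpace E] [BorelSpace E]
    {L : J → E →L[ℝ] E} (hL : ∀ i, Function.Injective (L i)) {R r : ℝ≥0} (hR : 1 ≤ R)
    (hr : r ≠ 0) {t : ℝ} (ht : 0 ≤ t) (htE : t ≤ finrank ℝ E) (w : List J) :
    volume (Metric.closedBall 0 R ∩ wordOperator L w ⁻¹' Metric.closedBall 0 r) ≤
      (2 * R) ^ finrank ℝ E * (r ^ t * (singularWeight L t w)⁻¹) := by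
  have injective := wordOperator_injective hL w
  have r_pos : (0 : ℝ) < r := NNReal.coe_pos.2 (pos_iff_ne_zero.2 hr)
  refine (volume_closedBall_inter_preimage_le_rpow (T := (wordOperator L w : E →ₗ[ℝ] E))
    injective (NNReal.one_le_coe.2 hR) ht htE r_pos).trans_eq ?_
  rw [ENNReal.ofReal_mul (by positivity),
    ENNReal.ofReal_div_of_pos (singularValueFunction_pos injective t),
    ENNReal.ofReal_pow (by positivity), ENNReal.ofReal_mul zero_le_two, ENNReal.ofReal_ofNat,
    ENNReal.ofReal_coe_nnreal, ← ENNReal.ofReal_rpow_of_pos r_pos, ENNReal.ofReal_coe_nnreal,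
    div_eq_mul_inv, singularWeight]

end SingularWeight

section Energy

theorem antitone_rpow_neg {τ : ℝ} (hτ : 0 ≤ τ) : Antitone fun z : ℝ≥0∞ => z ^ (-τ) := by
  intro a b hab
  simp only [ENNReal.rpow_neg]
  gcongr

theorem rpow_neg_le_one_add_tsum (z : ℝ≥0∞) {τ : ℝ} (hτ : 0 ≤ τ) :
    z ^ (-τ) ≤ 1 + ∑' n : ℕ, (Set.Iic (2⁻¹ ^ n)).indicator (fun _ => (2⁻¹ ^ (n + 1)) ^ (-τ)) z := by
  classical
  rcases lt_or_ge 1 z with one_lt | le_one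
  · exact (antitone_rpow_neg hτ one_lt.le).trans (by simp)
  rcases eq_or_ne z 0 with rfl | hz
  · have one_le_term (n : ℕ) : 1 ≤ (Set.Iic ((2 : ℝ≥0∞)⁻¹ ^ n)).indicator
        (fun _ => ((2 : ℝ≥0∞)⁻¹ ^ (n + 1)) ^ (-τ)) 0 := by
      rw [Set.indicator_of_mem (Set.mem_Iic.2 zero_le)]
      simpa using antitone_rpow_neg hτ (pow_le_one' ENNReal.one_half_lt_one.le (n + 1))
    have sum_top := ENNReal.tsum_le_tsum one_le_term
    rw [ENNReal.tsum_const_eq_top_of_ne_zero one_ne_zero, top_le_iff] at sum_top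
    exact le_top.trans_eq (by rw [sum_top, add_top])
  have exists_lt := ENNReal.exists_inv_two_pow_lt hz
  obtain ⟨n, hn⟩ : ∃ n, Nat.find exists_lt = n + 1 := by
    refine Nat.exists_eq_succ_of_ne_zero fun h => ?_
    simpa [h] using (Nat.find_spec exists_lt).trans_le le_one
  have le_z : (2 : ℝ≥0∞)⁻¹ ^ (n + 1) ≤ z := hn ▸ (Nat.find_spec exists_lt).le
  have z_le : z ≤ 2⁻¹ ^ n := not_lt.1 (Nat.find_min exists_lt (hn ▸ n.lt_succ_self))
  calc z ^ (-τ) ≤ (2⁻¹ ^ (n + 1)) ^ (-τ) := antitone_rpow_neg hτ le_z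
    _ = (Set.Iic (2⁻¹ ^ n)).indicator (fun _ => (2⁻¹ ^ (n + 1)) ^ (-τ)) z :=
        (Set.indicator_of_mem (Set.mem_Iic.2 z_le) fun _ => (2⁻¹ ^ (n + 1)) ^ (-τ)).symm
    _ ≤ _ := (ENNReal.le_tsum n).trans le_add_self

theorem rpow_neg_mul_rpow_inv_two_pow (τ t : ℝ) (n : ℕ) :
    ((2 : ℝ≥0∞)⁻¹ ^ (n + 1)) ^ (-τ) * (2⁻¹ ^ n) ^ t = 2 ^ τ * (2 ^ (τ - t)) ^ n := by
  simp only [ENNReal.inv_rpow, ENNReal.rpow_neg, inv_inv, ← ENNReal.rpow_natCast,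
    ← ENNReal.rpow_mul]
  rw [← ENNReal.rpow_neg, ← ENNReal.rpow_add _ _ two_ne_zero ENNReal.ofNat_ne_top,
    ← ENNReal.rpow_add _ _ two_ne_zero ENNReal.ofNat_ne_top]
  push_cast
  ring_nf

theorem lintegral_rpow_neg_le {Ω : Type*} [MeasurableSpace Ω] {P : Measure Ω}
    [IsProbabilityMeasure P] {Z : Ω → ℝ≥0∞} (hZ : Measurable Z) {D : ℝ≥0∞} {τ t : ℝ} (hτ : 0 ≤ τ)
    (h : ∀ r : ℝ≥0, r ≠ 0 → P {ω | Z ω ≤ r} ≤ D * r ^ t) :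
    ∫⁻ ω, Z ω ^ (-τ) ∂P ≤ 1 + D * (2 ^ τ * (1 - 2 ^ (τ - t))⁻¹) := by
  have dyadic_le (n : ℕ) : P (Z ⁻¹' Set.Iic (2⁻¹ ^ n)) ≤ D * (2⁻¹ ^ n) ^ t := by
    have := h (2⁻¹ ^ n) (by positivity)
    rwa [ENNReal.coe_pow, ENNReal.coe_inv two_ne_zero, ENNReal.coe_ofNat] at this
  calc ∫⁻ ω, Z ω ^ (-τ) ∂P
      ≤ ∫⁻ ω, 1 + ∑' n : ℕ,
          (Z ⁻¹' Set.Iic (2⁻¹ ^ n)).indicator (fun _ => (2⁻¹ ^ (n + 1)) ^ (-τ)) ω ∂P :=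
        lintegral_mono fun ω => rpow_neg_le_one_add_tsum (Z ω) hτ
    _ = 1 + ∑' n : ℕ, (2⁻¹ ^ (n + 1)) ^ (-τ) * P (Z ⁻¹' Set.Iic (2⁻¹ ^ n)) := by
        have measurable_term (n : ℕ) : MeasurableSet (Z ⁻¹' Set.Iic (2⁻¹ ^ n)) :=
          hZ measurableSet_Iic
        rw [lintegral_add_left measurable_const, lintegral_one, measure_univ,
          lintegral_tsum fun n => (measurable_const.indicator (measurable_term n)).aemeasurable]
        simp only [lintegral_indicator_const (measurable_term _)]
    _ ≤ 1 + ∑' n : ℕ, D * (2 ^ τ * (2 ^ (τ - t)) ^ n) := by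
        refine add_le_add_right (ENNReal.tsum_le_tsum fun n => ?_) _
        rw [← rpow_neg_mul_rpow_inv_two_pow, mul_left_comm]
        gcongr
        exact dyadic_le n
    _ = 1 + D * (2 ^ τ * (1 - 2 ^ (τ - t))⁻¹) := by
        rw [ENNReal.tsum_mul_left, ENNReal.tsum_mul_left, ENNReal.tsum_geometric]

variable {E : Type*} [EMetricSpace E] [MeasurableSpace E] [BorelSpace E]

theorem le_dimH_of_forall_measure_closedEBall_le {ν : Measure E} {S : Set E} {C : ℝ≥0∞}
    (hC : C ≠ ∞) {τ : ℝ≥0}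
    (h : ∀ x ∈ S, ∀ δ ≠ ∞, ν (Metric.closedEBall x δ) ≤ C * δ ^ (τ : ℝ)) (hS : ν S ≠ 0) :
    (τ : ℝ≥0∞) ≤ dimH S := by
  have le_hausdorff : (C + 1)⁻¹ • ν.restrict S ≤ Measure.hausdorffMeasure (τ : ℝ) := by
    refine Measure.le_hausdorffMeasure _ _ 1 one_pos fun s hs => ?_
    refine (measure_mono (subset_closure (s := s))).trans ?_
    rw [Measure.smul_apply, smul_eq_mul, Measure.restrict_apply isClosed_closure.measurableSet,
      mul_comm, ← div_eq_mul_inv]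
    refine ENNReal.div_le_of_le_mul' ?_
    rcases (closure s ∩ S).eq_empty_or_nonempty with empty | ⟨x, hx, hxS⟩
    · simp [empty]
    have subset_ball : closure s ⊆ Metric.closedEBall x (Metric.ediam s) := fun y hy => by
      rw [← Metric.ediam_closure]
      exact Metric.edist_le_ediam_of_mem hy hx
    calc ν (closure s ∩ S) ≤ ν (Metric.closedEBall x (Metric.ediam s)) :=
          measure_mono (Set.inter_subset_left.trans subset_ball)
      _ ≤ C * Metric.ediam s ^ (τ : ℝ) := h x hxS _ (ne_top_of_le_ne_top ENNReal.one_ne_top hs)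
      _ ≤ (C + 1) * Metric.ediam s ^ (τ : ℝ) := by gcongr; exact le_self_add
  refine le_dimH_of_hausdorffMeasure_ne_zero ((pos_iff_ne_zero.2 ?_).trans_le (le_hausdorff S)).ne'
  rw [Measure.smul_apply, Measure.restrict_apply_self]
  exact mul_ne_zero (by simp [hC]) hS

variable {Ω : Type*} [MeasurableSpace Ω] {μ : Measure Ω} {f : Ω → E}

theorem measure_preimage_closedEBall_le (hf : Measurable f) {τ : ℝ} (hτ : 0 ≤ τ) {x : E} {M : ℝ≥0∞}
    (hM : M ≠ ∞) (h : ∫⁻ y, edist x (f y) ^ (-τ) ∂μ ≤ M) {δ : ℝ≥0∞} (hδ : δ ≠ ∞) :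
    μ (f ⁻¹' Metric.closedEBall x δ) ≤ M * δ ^ τ := by
  have markov : δ ^ (-τ) * μ {y | δ ^ (-τ) ≤ edist x (f y) ^ (-τ)} ≤ M :=
    (mul_meas_ge_le_lintegral ((measurable_edist_right.comp hf).pow_const _) _).trans h
  rw [mul_comm, ENNReal.rpow_neg, ← div_eq_mul_inv, ENNReal.div_le_iff_le_mul (.inr hM)
    (.inl (ENNReal.rpow_ne_top_of_nonneg hτ hδ))] at markov
  refine (measure_mono fun y hy => ?_).trans markov
  rw [Set.mem_ofPred_eq, ENNReal.rpow_neg, ENNReal.inv_le_inv]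
  rw [Set.mem_preimage, Metric.mem_closedEBall'] at hy
  gcongr

theorem le_dimH_range_of_ae_lintegral_edist_lt_top [NeZero μ] (hf : Measurable f) {τ : ℝ≥0}
    (h : ∀ᵐ x ∂μ, ∫⁻ y, edist (f x) (f y) ^ (-τ : ℝ) ∂μ < ∞) :
    (τ : ℝ≥0∞) ≤ dimH (Set.range f) := by
  obtain ⟨M, hM⟩ : ∃ M : ℕ, μ {x | ∫⁻ y, edist (f x) (f y) ^ (-τ : ℝ) ∂μ ≤ M} ≠ 0 := by
    by_contra! null
    obtain ⟨x, hx, unbounded⟩ := (h.and (ae_all_iff.2 fun M => measure_eq_zero_iff_ae_notMem.1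
      (null M))).exists
    obtain ⟨M, hM⟩ := ENNReal.exists_nat_gt hx.ne
    exact unbounded M hM.le
  set G := {x | ∫⁻ y, edist (f x) (f y) ^ (-τ : ℝ) ∂μ ≤ M}
  refine (le_dimH_of_forall_measure_closedEBall_le (ν := μ.map f) (S := f '' G)
    (ENNReal.natCast_ne_top M) ?_ ?_).trans (dimH_mono (Set.image_subset_range f G))
  · rintro _ ⟨x, hx, rfl⟩ δ hδ
    rw [Measure.map_apply hf Metric.isClosed_closedEBall.measurableSet]
    exact measure_preimage_closedEBall_le hf τ.2 (ENNReal.natCast_ne_top M) hx hδ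
  · refine fun null => hM (measure_mono_null (Set.subset_preimage_image f G) ?_)
    exact le_zero_iff.1 ((Measure.le_map_apply hf.aemeasurable _).trans_eq null)

end Energy

section SmallBall

open Module

theorem measure_preimage_le_of_antilipschitzWith {E : Type*} [NormedAddCommGroup E]
    [NormedSpace ℝ E] [FiniteDimensional ℝ E] [MeasurableSpace E] [BorelSpace E] (μ : Measure E)
    [μ.IsAddHaarMeasure] {K : ℝ≥0} {f : E → E} (hf : AntilipschitzWith K f) (S : Set E) :
    μ (f ⁻¹' S) ≤ K ^ finrank ℝ E * μ S := by
  have hausdorff_le :=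
    hf.hausdorffMeasure_preimage_le (d := (finrank ℝ E : ℝ)) (Nat.cast_nonneg _) S
  rw [ENNReal.rpow_natCast] at hausdorff_le
  rw [Measure.isAddLeftInvariant_eq_smul μ (Measure.hausdorffMeasure (finrank ℝ E)),
    Measure.smul_apply, Measure.smul_apply, mul_smul_comm]
  gcongr

theorem measure_pi_le_of_forall_measure_update_le {J : Type*} [Fintype J] [DecidableEq J]
    {X : J → Type*} [∀ i, MeasurableSpace (X i)] (μ : ∀ i, Measure (X i))
    [∀ i, IsProbabilityMeasure (μ i)] {S : Set (∀ i, X i)} (hS : MeasurableSet S) (l : J)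
    {b : ℝ≥0∞} (h : ∀ v, μ l (Function.update v l ⁻¹' S) ≤ b) : Measure.pi μ S ≤ b := by
  rw [← lintegral_indicator_one hS]
  refine (lintegral_le_of_lmarginal_le (μ := μ) {l} (g := fun _ => b)
    (measurable_one.indicator hS) measurable_const fun v => ?_).trans_eq (by simp)
  rw [lmarginal_singleton, lmarginal_singleton, lintegral_const, measure_univ, mul_one]
  exact (lintegral_indicator_one (measurable_update v hS)).trans_le (h v)

variable {J E : Type*} [NormedAddCommGroup E] [InnerProductSpace ℝ E] [FiniteDimensional ℝ E]
  [MeasurableSpace E] [BorelSpace E] {L : J → E →L[ℝ] E} {α M R r : ℝ≥0} {t : ℝ} {x y : ℕ → J}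
  {n : ℕ}

theorem exists_volume_update_preimage_le [Finite J] [DecidableEq J]
    (hL : ∀ i, Function.Injective (L i)) (hL_norm : ∀ i, ‖L i‖ ≤ α) (hα : α < 1 / 2) (hR : 1 ≤ R)
    (hMR : 2 * ((1 - α)⁻¹ * M) ≤ R) (hr : r ≠ 0) (ht : 0 ≤ t) (htE : t ≤ finrank ℝ E)
    (hy : y ∈ PiNat.cylinder x n) (hxy : x n ≠ y n) :
    ∃ l, ∀ v : J → E, volume (Function.update v l ⁻¹'
      {v | (∀ i, ‖v i‖ ≤ M) ∧ edist (codingMap L v x) (codingMap L v y) ≤ r}) ≤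
        ((2 - (1 - α)⁻¹)⁻¹ : ℝ≥0) ^ finrank ℝ E * ((2 * R) ^ finrank ℝ E *
          (r ^ t * (singularWeight L t (initialWord x n))⁻¹)) := by
  have hα_one : α < 1 := hα.trans (NNReal.half_lt_self one_ne_zero)
  obtain ⟨l, hl⟩ := exists_antilipschitzWith_codingMap_update_sub hL_norm hα
    (x := fun j => x (n + j)) (y := fun j => y (n + j)) hxy
  have subset (v : J → E) : Function.update v l ⁻¹'
      {v | (∀ i, ‖v i‖ ≤ M) ∧ edist (codingMap L v x) (codingMap L v y) ≤ r} ⊆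
      (fun a => codingMap L (Function.update v l a) (fun j => x (n + j)) -
        codingMap L (Function.update v l a) fun j => y (n + j)) ⁻¹'
        (Metric.closedBall 0 R ∩ wordOperator L (initialWord x n) ⁻¹' Metric.closedBall 0 r) := by
    rintro a ⟨norm_le, ha⟩
    have norm_codingMap_le (z : ℕ → J) :
        ‖codingMap L (Function.update v l a) z‖ ≤ ((1 - α)⁻¹ * M : ℝ≥0) := by
      refine (norm_codingMap_le hL_norm hα_one norm_le z).trans_eq ?_
      rw [NNReal.coe_mul, NNReal.coe_inv, NNReal.coe_sub hα_one.le, NNReal.coe_one]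
    refine ⟨?_, ?_⟩
    · rw [mem_closedBall_zero_iff]
      refine (norm_sub_le_of_le (norm_codingMap_le _) (norm_codingMap_le _)).trans ?_
      rw [← NNReal.coe_add, ← two_mul]
      exact NNReal.coe_le_coe.2 hMR
    · rw [Set.mem_preimage, mem_closedBall_zero_iff,
        ← codingMap_sub_codingMap_of_mem_cylinder hL_norm hα_one _ hy, ← dist_eq_norm]
      exact edist_le_coe.1 ha
  exact ⟨l, fun v => (measure_mono (subset v)).trans
    ((measure_preimage_le_of_antilipschitzWith volume (hl v) _).trans (mul_le_mul_right
      (volume_closedBall_inter_preimage_wordOperator_le hL hR hr ht htE (initialWord x n)) _))⟩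

theorem exists_measure_pi_edist_codingMap_le [Fintype J] {ν : Measure E} [IsProbabilityMeasure ν]
    {c : ℝ≥0∞} (hc : c ≠ ∞) (hν : ν ≤ c • volume) (hν_norm : ∀ᵐ a ∂ν, ‖a‖ ≤ M)
    (hL : ∀ i, Function.Injective (L i)) (hL_norm : ∀ i, ‖L i‖ ≤ α) (hα : α < 1 / 2)
    (ht : 0 ≤ t) (htE : t ≤ finrank ℝ E) :
    ∃ C : ℝ≥0∞, C ≠ ∞ ∧ ∀ (x y : ℕ → J) (n : ℕ) (r : ℝ≥0), y ∈ PiNat.cylinder x n → x n ≠ y n →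
      r ≠ 0 → Measure.pi (fun _ : J => ν) {v | edist (codingMap L v x) (codingMap L v y) ≤ r} ≤
        C * ((singularWeight L t (initialWord x n))⁻¹ * r ^ t) := by
  classical
  let R := max 1 (2 * ((1 - α)⁻¹ * M))
  refine ⟨c * ((2 - (1 - α)⁻¹)⁻¹ : ℝ≥0) ^ finrank ℝ E * (2 * R) ^ finrank ℝ E, by finiteness,
    fun x y n r hy hxy hr => ?_⟩
  obtain ⟨l, hl⟩ := exists_volume_update_preimage_le hL hL_norm hα (R := R) (M := M)
    (le_max_left _ _) (le_max_right _ _) hr ht htE hy hxy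
  set S := {v : J → E | (∀ i, ‖v i‖ ≤ M) ∧ edist (codingMap L v x) (codingMap L v y) ≤ r}
  have S_measurable : MeasurableSet S := by
    let : MeasurableSpace J := ⊤
    have : DiscreteMeasurableSpace J := ⟨fun _ => trivial⟩
    have codingMap_measurable (z : ℕ → J) : Measurable fun v => codingMap L v z :=
      (measurable_codingMap hL_norm (hα.trans (NNReal.half_lt_self one_ne_zero))).comp
        measurable_prodMk_right
    have norm_measurable : MeasurableSet {v : J → E | ∀ i, ‖v i‖ ≤ M} := by
      rw [Set.ofPred_forall]
      exact .iInter fun i => measurableSet_le (measurable_pi_apply i).norm measurable_const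
    exact norm_measurable.inter (measurableSet_le
      ((codingMap_measurable x).edist (codingMap_measurable y)) measurable_const)
  have ae_norm_le : ∀ᵐ v ∂Measure.pi (fun _ : J => ν), ∀ i, ‖v i‖ ≤ M :=
    ae_all_iff.2 fun i =>
      (Measure.tendsto_eval_ae_ae (μ := fun _ : J => ν) (i := i)).eventually hν_norm
  calc Measure.pi (fun _ : J => ν) {v | edist (codingMap L v x) (codingMap L v y) ≤ r}
      ≤ Measure.pi (fun _ : J => ν) S :=
        measure_mono_ae (ae_norm_le.mono fun v hv h => ⟨hv, h⟩)
    _ ≤ c * (((2 - (1 - α)⁻¹)⁻¹ : ℝ≥0) ^ finrank ℝ E * ((2 * R) ^ finrank ℝ E *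
          (r ^ t * (singularWeight L t (initialWord x n))⁻¹))) :=
        measure_pi_le_of_forall_measure_update_le _ S_measurable l fun v =>
          (hν _).trans (mul_le_mul_right (hl v) c)
    _ = _ := by ring

end SmallBall

section CommonPrefix

open Module

variable {J E : Type*} [NormedAddCommGroup E] [InnerProductSpace ℝ E] [FiniteDimensional ℝ E]
  {L : J → E →L[ℝ] E} {s t : ℝ}

/-- The sum of `φ^t(L_w)⁻¹` over all common prefixes `w` of `x` and `y`. Summing, instead of taking
the longest common prefix only, makes it infinite on the diagonal. -/
def commonPrefixSum (L : J → E →L[ℝ] E) (t : ℝ) (x y : ℕ → J) : ℝ≥0∞ :=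
  ∑' n, (PiNat.cylinder x n).indicator (fun _ => (singularWeight L t (initialWord x n))⁻¹) y

theorem commonPrefixSum_self (hL : ∀ i, Function.Injective (L i)) (hL_norm : ∀ i, ‖L i‖ ≤ 1)
    (ht : 0 ≤ t) (htE : t ≤ finrank ℝ E) (x : ℕ → J) : commonPrefixSum L t x x = ∞ := by
  refine top_le_iff.1 ?_
  rw [← ENNReal.tsum_const_eq_top_of_ne_zero (α := ℕ) one_ne_zero]
  refine ENNReal.tsum_le_tsum fun n => ?_
  rw [Set.indicator_of_mem (PiNat.self_mem_cylinder x n), ENNReal.one_le_inv]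
  exact singularWeight_le_one hL hL_norm ht htE _

theorem inv_singularWeight_le_commonPrefixSum (L : J → E →L[ℝ] E) (t : ℝ) {x y : ℕ → J} {n : ℕ}
    (hy : y ∈ PiNat.cylinder x n) :
    (singularWeight L t (initialWord x n))⁻¹ ≤ commonPrefixSum L t x y := by
  refine le_trans ?_ (ENNReal.le_tsum n)
  rw [Set.indicator_of_mem hy]

theorem lintegral_commonPrefixSum_le [Countable J] [MeasurableSpace J] [DiscreteMeasurableSpace J]
    (hL : ∀ i, Function.Injective (L i)) {α : ℝ≥0} (hα_pos : 0 < α) (hL_norm : ∀ i, ‖L i‖ ≤ α)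
    (ht : 0 ≤ t) (hts : t ≤ s) (hs : s ≤ finrank ℝ E) {μ : Measure (ℕ → J)} {K : ℝ≥0∞}
    {x : ℕ → J} (hμ : ∀ n, μ (PiNat.cylinder x n) ≤ K * singularWeight L s (initialWord x n)) :
    ∫⁻ y, commonPrefixSum L t x y ∂μ ≤ K * (1 - (α : ℝ≥0∞) ^ (s - t))⁻¹ := by
  simp only [commonPrefixSum]
  rw [lintegral_tsum fun n =>
    (measurable_const.indicator (measurableSet_cylinder x n)).aemeasurable,
    ← ENNReal.tsum_geometric, ← ENNReal.tsum_mul_left]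
  refine ENNReal.tsum_le_tsum fun n => ?_
  rw [lintegral_indicator_const (measurableSet_cylinder x n)]
  set w := initialWord x n
  have length_w : w.length = n := length_initialWord x n
  calc (singularWeight L t w)⁻¹ * μ (PiNat.cylinder x n)
      ≤ (singularWeight L t w)⁻¹ * (K * (((α : ℝ≥0∞) ^ (s - t)) ^ n * singularWeight L t w)) := by
        grw [hμ n, singularWeight_le_rpow_mul hL hα_pos hL_norm ht hts hs w, length_w]
    _ = K * ((α : ℝ≥0∞) ^ (s - t)) ^ n * ((singularWeight L t w)⁻¹ * singularWeight L t w) := by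
        ring
    _ = K * ((α : ℝ≥0∞) ^ (s - t)) ^ n := by
        rw [ENNReal.inv_mul_cancel (singularWeight_ne_zero hL t w) (singularWeight_ne_top L t w),
          mul_one]

end CommonPrefix

section FiniteSystem

open Module

variable {J E : Type*} [Fintype J] [NormedAddCommGroup E] [InnerProductSpace ℝ E]
  [FiniteDimensional ℝ E] [MeasurableSpace E] [BorelSpace E] {L : J → E →L[ℝ] E} {α M : ℝ≥0}
  {ν : Measure E} [IsProbabilityMeasure ν] {c : ℝ≥0∞} {s t τ : ℝ}

theorem exists_measure_pi_edist_codingMap_le_commonPrefixSum (hc : c ≠ ∞) (hν : ν ≤ c • volume)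
    (hν_norm : ∀ᵐ a ∂ν, ‖a‖ ≤ M) (hL : ∀ i, Function.Injective (L i)) (hL_norm : ∀ i, ‖L i‖ ≤ α)
    (hα : α < 1 / 2) (ht : 0 ≤ t) (htE : t ≤ finrank ℝ E) :
    ∃ C : ℝ≥0∞, C ≠ ∞ ∧ ∀ (x y : ℕ → J) (r : ℝ≥0), r ≠ 0 →
      Measure.pi (fun _ : J => ν) {v | edist (codingMap L v x) (codingMap L v y) ≤ r} ≤
        C * commonPrefixSum L t x y * r ^ t := by
  obtain ⟨C, hC, small_ball⟩ :=
    exists_measure_pi_edist_codingMap_le hc hν hν_norm hL hL_norm hα ht htE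
  refine ⟨C + 1, by finiteness, fun x y r hr => ?_⟩
  rcases eq_or_ne y x with rfl | hyx
  · have hα_one : (α : ℝ) ≤ 1 := (hα.trans (NNReal.half_lt_self one_ne_zero)).le
    rw [commonPrefixSum_self hL (fun i => (hL_norm i).trans hα_one) ht htE,
      ENNReal.mul_top (by simp), ENNReal.top_mul]
    · exact le_top
    · exact (ENNReal.rpow_pos (by positivity) ENNReal.coe_ne_top).ne'
  · have hy := PiNat.mem_cylinder_firstDiff y x
    refine (small_ball x y _ r hy (PiNat.apply_firstDiff_ne hyx).symm hr).trans ?_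
    grw [inv_singularWeight_le_commonPrefixSum L t hy, ← mul_assoc, ← le_self_add (a := C)]

section Energy

variable [MeasurableSpace J] [DiscreteMeasurableSpace J]

theorem lintegral_lintegral_edist_codingMap_lt_top (hc : c ≠ ∞) (hν : ν ≤ c • volume)
    (hν_norm : ∀ᵐ a ∂ν, ‖a‖ ≤ M) (hL : ∀ i, Function.Injective (L i)) (hα_pos : 0 < α)
    (hL_norm : ∀ i, ‖L i‖ ≤ α) (hα : α < 1 / 2) (hτ : 0 ≤ τ) (hτt : τ < t) (hts : t < s)
    (hsE : s ≤ finrank ℝ E) {μ : Measure (ℕ → J)} [IsProbabilityMeasure μ] {K : ℝ≥0∞}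
    (hK : K ≠ ∞) {x : ℕ → J}
    (hμ : ∀ n, μ (PiNat.cylinder x n) ≤ K * singularWeight L s (initialWord x n)) :
    ∫⁻ v, ∫⁻ y, edist (codingMap L v x) (codingMap L v y) ^ (-τ) ∂μ ∂Measure.pi (fun _ : J => ν)
      < ∞ := by
  have hα_one : α < 1 := hα.trans (NNReal.half_lt_self one_ne_zero)
  have ht : 0 ≤ t := hτ.trans hτt.le
  obtain ⟨C, hC, small_ball⟩ := exists_measure_pi_edist_codingMap_le_commonPrefixSum hc hν hν_norm
    hL hL_norm hα ht (hts.le.trans hsE)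
  have measurable_codingMap_left (z : ℕ → J) : Measurable fun v => codingMap L v z :=
    (measurable_codingMap hL_norm hα_one).comp measurable_prodMk_right
  set B : ℝ≥0∞ := 2 ^ τ * (1 - 2 ^ (τ - t))⁻¹
  have B_ne_top : B ≠ ∞ := by
    have : (2 : ℝ≥0∞) ^ (τ - t) < 1 :=
      ENNReal.rpow_lt_one_of_one_lt_of_neg ENNReal.one_lt_two (sub_neg.2 hτt)
    exact ENNReal.mul_ne_top (by finiteness) (ENNReal.inv_ne_top.2 (tsub_pos_of_lt this).ne')
  have geometric_ne_top : (1 - (α : ℝ≥0∞) ^ (s - t))⁻¹ ≠ ∞ :=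
    ENNReal.inv_ne_top.2 (tsub_pos_of_lt (ENNReal.rpow_lt_one (mod_cast hα_one)
      (sub_pos.2 hts))).ne'
  rw [lintegral_lintegral_swap]
  · calc ∫⁻ y, ∫⁻ v, edist (codingMap L v x) (codingMap L v y) ^ (-τ)
          ∂Measure.pi (fun _ : J => ν) ∂μ
        ≤ ∫⁻ y, 1 + C * commonPrefixSum L t x y * B ∂μ :=
          lintegral_mono fun y => lintegral_rpow_neg_le
            ((measurable_codingMap_left x).edist (measurable_codingMap_left y)) hτ (small_ball x y)
      _ = 1 + C * (∫⁻ y, commonPrefixSum L t x y ∂μ) * B := by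
          rw [lintegral_add_left measurable_const, lintegral_mul_const' _ _ B_ne_top,
            lintegral_const_mul' _ _ hC, lintegral_one, measure_univ]
      _ ≤ 1 + C * (K * (1 - (α : ℝ≥0∞) ^ (s - t))⁻¹) * B := by
          grw [lintegral_commonPrefixSum_le hL hα_pos hL_norm ht hts.le hsE hμ]
      _ < ∞ := by finiteness
  · exact ((measurable_edist_codingMap_rpow hL_norm hα_one (-τ)).comp
      ((measurable_fst.prodMk measurable_const).prodMk measurable_snd)).aemeasurable

theorem ae_ae_lintegral_edist_codingMap_lt_top (hc : c ≠ ∞) (hν : ν ≤ c • volume)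
    (hν_norm : ∀ᵐ a ∂ν, ‖a‖ ≤ M) (hL : ∀ i, Function.Injective (L i)) (hα_pos : 0 < α)
    (hL_norm : ∀ i, ‖L i‖ ≤ α) (hα : α < 1 / 2) (hτ : 0 ≤ τ) (hτt : τ < t) (hts : t < s)
    (hsE : s ≤ finrank ℝ E) {μ : Measure (ℕ → J)} [IsProbabilityMeasure μ] {K : ℝ≥0∞}
    (hK : K ≠ ∞)
    (hμ : ∀ x n, μ (PiNat.cylinder x n) ≤ K * singularWeight L s (initialWord x n)) :
    ∀ᵐ v ∂Measure.pi (fun _ : J => ν), ∀ᵐ x ∂μ,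
      ∫⁻ y, edist (codingMap L v x) (codingMap L v y) ^ (-τ) ∂μ < ∞ := by
  have hα_one : α < 1 := hα.trans (NNReal.half_lt_self one_ne_zero)
  let potential (v : J → E) (x : ℕ → J) : ℝ≥0∞ :=
    ∫⁻ y, edist (codingMap L v x) (codingMap L v y) ^ (-τ) ∂μ
  have potential_measurable : Measurable (Function.uncurry potential) :=
    (measurable_edist_codingMap_rpow hL_norm hα_one (-τ)).lintegral_prod_right'
  have ae_potential_lt_top (x : ℕ → J) : ∀ᵐ v ∂Measure.pi (fun _ : J => ν), potential v x < ∞ :=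
    ae_lt_top potential_measurable.of_uncurry_right
      (lintegral_lintegral_edist_codingMap_lt_top hc hν hν_norm hL hα_pos hL_norm hα hτ hτt hts
        hsE hK (hμ x)).ne
  exact (Measure.ae_ae_comm (p := fun v x => potential v x < ∞)
    (measurableSet_lt potential_measurable measurable_const)).2
      (.of_forall ae_potential_lt_top)

end Energy

theorem ae_le_dimH_range_codingMap (hc : c ≠ ∞) (hν : ν ≤ c • volume)
    (hν_norm : ∀ᵐ a ∂ν, ‖a‖ ≤ M) (hL : ∀ i, Function.Injective (L i))
    (hL_norm : ∀ i, ‖L i‖ < 1 / 2) {τ : ℝ≥0} (hτs : τ < s) (hsE : s < finrank ℝ E)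
    (h : 0 ≤ limsup (fun n : ℕ => ENNReal.log (levelSum (singularWeight L s) n) / (n : EReal))
      atTop) :
    ∀ᵐ v ∂Measure.pi (fun _ : J => ν), τ ≤ dimH (Set.range (codingMap L v)) := by
  let : MeasurableSpace J := ⊤
  have : DiscreteMeasurableSpace J := ⟨fun _ => trivial⟩
  obtain ⟨α, hα_pos, hα, norm_le⟩ : ∃ α : ℝ≥0, 0 < α ∧ α < 1 / 2 ∧ ∀ i, ‖L i‖ ≤ α := by
    obtain ⟨α, hα, nnnorm_lt⟩ : ∃ α < (1 / 2 : ℝ≥0), ∀ i, ‖L i‖₊ ≤ α :=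
      ⟨Finset.univ.sup fun i => ‖L i‖₊, (Finset.sup_lt_iff (by simp)).2 fun i _ => hL_norm i,
        fun i => Finset.le_sup (f := fun i => ‖L i‖₊) (Finset.mem_univ i)⟩
    obtain ⟨β, hαβ, hβ⟩ := exists_between hα
    exact ⟨β, zero_le.trans_lt hαβ, hβ, fun i => (nnnorm_lt i).trans hαβ.le⟩
  obtain ⟨t, hτt, hts⟩ := exists_between hτs
  have hs : 0 ≤ s := τ.2.trans hτs.le
  obtain ⟨K, one_le_K, hK, append_le⟩ := exists_singularWeight_append_le hL hs hsE
  obtain ⟨μ, μ_prob, hμ⟩ := exists_measure_cylinder_le (singularWeight_ne_top L s) append_le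
    (tsum_levelSum_eq_top_of_limsup_log_div_nonneg one_le_K hK append_le h)
  filter_upwards [ae_ae_lintegral_edist_codingMap_lt_top hc hν hν_norm hL hα_pos norm_le hα τ.2
    hτt hts hsE.le hK hμ] with v hv
  exact le_dimH_range_of_ae_lintegral_edist_lt_top ((measurable_codingMap norm_le
    (hα.trans (NNReal.half_lt_self one_ne_zero))).comp measurable_prodMk_left) hv

end FiniteSystem

section AffinityDimension

variable {d : ℕ} {ι : Type*}

theorem svf_eq_singularValueFunction {s : ℝ≥0} (hs : s < d) (M : Matrix (Fin d) (Fin d) ℝ) :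
    svf s M = singularValueFunction s (Matrix.toEuclideanLin M) := by
  have hs' : (s : ℝ) < Module.finrank ℝ (EuclideanSpace ℝ (Fin d)) := by
    rw [finrank_euclideanSpace_fin]
    exact_mod_cast hs
  rw [svf, if_pos hs.le]
  exact (singularValueFunction_eq_prod_range_floor (Matrix.toEuclideanLin M) s.2 hs').symm

theorem toEuclideanCLM_injective (M : GL (Fin d) ℝ) :
    Function.Injective (Matrix.toEuclideanCLM (n := Fin d) (𝕜 := ℝ)
      (M : Matrix (Fin d) (Fin d) ℝ)) := by
  have left_inverse : Matrix.toEuclideanCLM (n := Fin d) (𝕜 := ℝ)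
      ((M⁻¹ : GL (Fin d) ℝ) : Matrix (Fin d) (Fin d) ℝ) *
      Matrix.toEuclideanCLM (n := Fin d) (𝕜 := ℝ) (M : Matrix (Fin d) (Fin d) ℝ) = 1 := by
    rw [← map_mul, Units.inv_mul, map_one]
  exact Function.LeftInverse.injective (g := Matrix.toEuclideanCLM (n := Fin d) (𝕜 := ℝ)
    ((M⁻¹ : GL (Fin d) ℝ) : Matrix (Fin d) (Fin d) ℝ)) fun u => DFunLike.congr_fun left_inverse u

/-- The tuple of the linear parts `A_i`, as operators on Euclidean space. -/
def linearPart (A : ι → GL (Fin d) ℝ) (i : ι) :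
    EuclideanSpace ℝ (Fin d) →L[ℝ] EuclideanSpace ℝ (Fin d) :=
  Matrix.toEuclideanCLM (n := Fin d) (𝕜 := ℝ) (A i : Matrix (Fin d) (Fin d) ℝ)

theorem wordOperator_linearPart_ofFn (A : ι → GL (Fin d) ℝ) {n : ℕ} (w : Fin n → ι) :
    wordOperator (linearPart A) (List.ofFn w) = Matrix.toEuclideanCLM (n := Fin d) (𝕜 := ℝ)
      (wordProd A w : Matrix (Fin d) (Fin d) ℝ) := by
  rw [wordOperator, wordProd, ← Units.coeHom_apply, map_list_prod, map_list_prod, List.map_ofFn,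
    List.map_ofFn, List.map_ofFn]
  rfl

theorem svfSum_eq_levelSum [Fintype ι] (A : ι → GL (Fin d) ℝ) {s : ℝ≥0} (hs : s < d) (n : ℕ) :
    svfSum A s n = levelSum (singularWeight (linearPart A) s) n := by
  rw [svfSum, tsum_fintype, levelSum]
  refine Finset.sum_congr rfl fun w _ => ?_
  rw [singularWeight, wordOperator_linearPart_ofFn, svf_eq_singularValueFunction hs,
    Matrix.coe_toEuclideanCLM_eq_toEuclideanLin]

theorem pressure_nonneg_of_lt_upperAffinityDim {A : ι → GL (Fin d) ℝ} {s : ℝ≥0}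
    (hs : s < upperAffinityDim A) : 0 ≤ pressure A s :=
  not_lt.1 fun pressure_neg => hs.not_ge (iInf₂_le s pressure_neg)

end AffinityDimension

section Reduction

variable {d : ℕ} {ι : Type*}

theorem norm_le_of_mem_unitCube {x : EuclideanSpace ℝ (Fin d)} (hx : x ∈ unitCube d) :
    ‖x‖ ≤ √d := by
  rw [EuclideanSpace.norm_eq]
  refine Real.sqrt_le_sqrt ?_
  calc ∑ i, ‖x i‖ ^ 2 ≤ ∑ _i : Fin d, (1 : ℝ) := Finset.sum_le_sum fun i _ => by
        rw [Real.norm_of_nonneg (hx i).1]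
        exact pow_le_one₀ (hx i).1 (hx i).2
    _ = d := by simp

theorem ae_cubeMeasure_norm_le (d : ℕ) : ∀ᵐ a ∂cubeMeasure d, ‖a‖ ≤ √d := by
  have measurableSet_unitCube : MeasurableSet (unitCube d) := by
    rw [unitCube, Set.ofPred_forall]
    exact .iInter fun k =>
      (EuclideanSpace.proj (𝕜 := ℝ) k).continuous.measurable measurableSet_Icc
  exact (ae_restrict_mem measurableSet_unitCube).mono fun _ => norm_le_of_mem_unitCube

theorem range_codingMap_subset_selfAffineSet {A : ι → GL (Fin d) ℝ} {J : Finset ι} {α : ℝ≥0}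
    (hA : ∀ i : J, ‖linearPart A i‖ ≤ α) (hα : α < 1) (v : ι → EuclideanSpace ℝ (Fin d)) :
    Set.range (codingMap (fun i : J => linearPart A i) (J.restrict v)) ⊆ selfAffineSet A v := by
  rintro _ ⟨x, rfl⟩
  exact ⟨fun k => x k, tendsto_iterComp_codingMap (L := fun i : J => linearPart A i) hA hα
    (J.restrict v) x⟩

theorem ae_le_dimH_selfAffineSet {A : ι → GL (Fin d) ℝ} (hA : ∀ i, ‖linearPart A i‖ < 1 / 2)
    (J : Finset ι) {τ : ℝ≥0} (hτd : (τ : ℝ≥0∞) < d)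
    (hτ : (τ : ℝ≥0∞) < upperAffinityDim fun i : J => A i) :
    ∀ᵐ v ∂translationMeasure d ι, (τ : ℝ≥0∞) ≤ dimH (selfAffineSet A v) := by
  obtain ⟨s, hτs, hs⟩ := ENNReal.lt_iff_exists_nnreal_btwn.1 (lt_min hτd hτ)
  have hsd : s < d := by exact_mod_cast hs.trans_le (min_le_left _ _)
  have pressure_nonneg := pressure_nonneg_of_lt_upperAffinityDim (hs.trans_le (min_le_right _ _))
  simp only [pressure, svfSum_eq_levelSum _ hsd] at pressure_nonneg
  have finite_system := ae_le_dimH_range_codingMap (c := 1) (M := NNReal.sqrt d)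
    (L := linearPart fun i : J => A i) (ν := cubeMeasure d) ENNReal.one_ne_top
    (by rw [one_smul]; exact Measure.restrict_le_self)
    (by simpa using ae_cubeMeasure_norm_le d) (fun i => toEuclideanCLM_injective (A i))
    (fun i => hA i) (ENNReal.coe_lt_coe.1 hτs)
    (by rw [finrank_euclideanSpace_fin]; exact_mod_cast hsd) pressure_nonneg
  rw [← Measure.infinitePi_map_restrict fun _ : ι => cubeMeasure d] at finite_system
  filter_upwards [ae_of_ae_map (Finset.measurable_restrict J).aemeasurable finite_system] with v hv
  exact hv.trans (dimH_mono (range_codingMap_subset_selfAffineSet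
    (α := 1 / 2) (fun i => by exact_mod_cast (hA i).le) (NNReal.half_lt_self one_ne_zero) v))

end Reduction

end SelfAffine

end

theorem mainTheorem12_general {d : ℕ} {ι : Type*} (A : ι → GL (Fin d) ℝ)
    (hA : ∀ i, ‖Matrix.toEuclideanCLM (n := Fin d) (𝕜 := ℝ)
      (A i : Matrix (Fin d) (Fin d) ℝ)‖ < 1 / 2) :
    ∀ᵐ v ∂(SelfAffine.translationMeasure d ι),
      min (d : ℝ≥0∞) (SelfAffine.lowerAffinityDim A) ≤ dimH (SelfAffine.selfAffineSet A v) := by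
  suffices min (d : ℝ≥0∞) (SelfAffine.lowerAffinityDim A) ≤
      essInf (fun v => dimH (SelfAffine.selfAffineSet A v)) (SelfAffine.translationMeasure d ι) from
    (ae_essInf_le (μ := SelfAffine.translationMeasure d ι)).mono fun v hv => this.trans hv
  refine ENNReal.le_of_forall_nnreal_lt fun τ hτ => le_essInf_of_ae_le _ ?_
  obtain ⟨hτd, hτA⟩ := lt_min_iff.1 hτ
  simp only [SelfAffine.lowerAffinityDim, lt_iSup_iff] at hτA
  obtain ⟨J, -, hτJ⟩ := hτA
  exact SelfAffine.ae_le_dimH_selfAffineSet hA J hτd hτJ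

theorem mainTheorem12 {d : ℕ} {ι : Type*} [Countable ι] [Nonempty ι]
    (A : ι → GL (Fin d) ℝ)
    (hA : (⨆ i, ‖Matrix.toEuclideanCLM (n := Fin d) (𝕜 := ℝ)
      (A i : Matrix (Fin d) (Fin d) ℝ)‖ₑ) < (1 / 2 : ℝ≥0∞)) :
    ∀ᵐ v ∂(SelfAffine.translationMeasure d ι),
      min (d : ℝ≥0∞) (SelfAffine.lowerAffinityDim A) ≤ dimH (SelfAffine.selfAffineSet A v) := by
  exact mainTheorem12_general A fun i => by
    simpa using ENNReal.toReal_strict_mono (by simp) (lt_of_le_of_lt (le_iSup _ i) hA)
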